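/- Let $\{Q_{2,p}\}_{p\ge 2}$ and $\{Q_{1,p}\}_{p\ge 2}$ be sequences of complex polynomials such that for every $p\ge 2$ $$Q_{2,p}(z)=\prod_{l=1}^{p}(z-\zeta_{l,p}),\qquad \frac{Q_{1,p}(z)}{Q_{2,p}(z)}=\sum_{l=1}^{p}\frac{a_{l,p}}{z-\zeta_{l,p}},\qquad \zeta_{l,p}\in\mathbb C,\ a_{l,p}>0,$$ and such that the generalized Lamé equation $Q_{2,p}y''+Q_{1,p}y'+Q_0y=0$ is solvable: for every integer $n\ge 1$ there are a polynomial $V$ with $\deg V\le p-2$ (a Van Vleck polynomial) and a polynomial $S$ with $\deg S=n$ (a corresponding Heine–Stieltjes polynomial) satisfying $Q_{2,p}S''+Q_{1,p}S'+VS=0$. Let $K\subset\mathbb C$ be a compact set containing all zeros of $Q_{2,p}$ for all $p\ge2$, and let $\operatorname{co}(K)$ be its convex hull. For $p\ge 2$ and $n\ge 1$ let $S_{p,n}$ be a monic Heine–Stieltjes polynomial of degree $n$, and let $V_{p,n}$ be monic of degree $p-2$ and a nonzero constant multiple of a Van Vleck polynomial that corresponds to $S_{p,n}$. Let $p\mapsto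 n(p)\ge 1$ be an arbitrary sequence of integers. For a polynomial $P$ of degree $d\ge1$ let $\mu_P=\frac1d\sum_{\zeta}\delta_\zeta$, summed over the zeros of $P$ with multiplicity. For a compact set $L\subset\mathbb C$ let $\mathcal M(L)$ be the set of Borel probability measures supported in $L$. For $L$ convex and compact and $\mu,\nu\in\mathcal M(L)$ write $\mu\prec\nu$ if $\int f\,d\mu\le\int f\,d\nu$ for every continuous convex function $f:L\to\mathbb R$. A dilation on $L$ is a map $T:L\to\mathcal M(L)$, $x\mapsto T_x$, such that $\int y\,dT_x(y)=x$ for all $x\in L$ and $x\mapsto\int f\,dT_x$ is Borel for every real continuous function $f$ on $L$; $\nu=T(\mu)$ means $\int f\,d\nu=\int_L\big(\int f\,dT_x\big)\,d\mu(x)$ for all such $f$. Then there is an infinite set $\Gamma\subset\mathbb N$ for which the weak-$*$ limits $${}_*\mu_V=\lim_{\Gamma\ni p\to\infty}\mu_{V_{p,n(p)}},\qquad {}_*\mu_{Q_2}=\lim_{\Gamma\ni p\to\infty}\mu_{Q_{2,p}}$$ exist, and for every infinite $\Gamma\subset\mathbb N$ for which both limits exist the following hold: 1. ${}_*\mu_V\in\mathcal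 M(\operatorname{co}(K))$, ${}_*\mu_{Q_2}\in\mathcal M(K)$, and ${}_*\mu_V\prec{}_*\mu_{Q_2}$ on $\operatorname{co}(K)$; 2. there is a dilation $T$ on $\operatorname{co}(K)$ with ${}_*\mu_{Q_2}=T({}_*\mu_V)$; 3. $\int|w|^m\,d\,{}_*\mu_V(w)\le\int|w|^m\,d\,{}_*\mu_{Q_2}(w)$ for all integers $m\ge0$; 4. $\int\log|z-w|\,d\,{}_*\mu_V(w)\ge\int\log|z-w|\,d\,{}_*\mu_{Q_2}(w)$ for all $z\in\mathbb C\setminus\operatorname{co}(K)$. In particular, if $K$ is convex, then $\operatorname{co}(K)=K$ throughout. -/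

import Mathlib

open MeasureTheory Filter Topology Polynomial
open scoped NNReal

namespace Lame

/-- The pair `(Q₂, Q₁)` is such that `Q₂ = ∏ (z - ζ_l)` and
`Q₁ / Q₂ = ∑ a_l / (z - ζ_l)` with `p` (not necessarily distinct) complex numbers `ζ_l`
and `p` positive numbers `a_l`. -/
def IsAdmissiblePair (p : ℕ) (Q₂ Q₁ : ℂ[X]) : Prop :=
  ∃ (ζ : Fin p → ℂ) (a : Fin p → ℝ), (∀ l, 0 < a l) ∧
    Q₂ = ∏ l, (X - C (ζ l)) ∧
    ∀ z : ℂ, Q₂.eval z ≠ 0 → Q₁.eval z / Q₂.eval z = ∑ l, (a l : ℂ) / (z - ζ l)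

/-- `V` is a Van Vleck polynomial and `S` a corresponding Heine-Stieltjes polynomial of degree
`n` for the generalized Lamé equation `Q₂ y'' + Q₁ y' + Q₀ y = 0` with `deg Q₂ = p`:
the degree of `V` is at most `p - 2` and the equation holds for `Q₀ = V`, `y = S`. -/
def IsSpectralPair (p n : ℕ) (Q₂ Q₁ V S : ℂ[X]) : Prop :=
  V.degree ≤ (p - 2 : ℕ) ∧ S.degree = n ∧
    Q₂ * derivative (derivative S) + Q₁ * derivative S + V * S = 0

/-- The generalized Lamé equation is solvable: it is `n`-solvable for all integers `n ≥ 1`. -/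
def IsSolvable (p : ℕ) (Q₂ Q₁ : ℂ[X]) : Prop :=
  ∀ n : ℕ, 1 ≤ n → ∃ V S : ℂ[X], IsSpectralPair p n Q₂ Q₁ V S

/-- The root-counting measure `|Z(P)|⁻¹ ∑_{ζ ∈ Z(P)} δ_ζ`, zeros taken with multiplicity.
It is a probability measure whenever `P` is not constant. -/
noncomputable def rootCountingMeasure (P : ℂ[X]) : FiniteMeasure ℂ :=
  (P.roots.card : ℝ≥0)⁻¹ •
    (P.roots.map fun ζ => (diracProba ζ).toFiniteMeasure).sum

/-- The set of all Borel probability measures that are supported in the closed set `K`. -/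
def probOn (K : Set ℂ) : Set (Measure ℂ) :=
  {μ | IsProbabilityMeasure μ ∧ μ Kᶜ = 0}

/-- The barycenter `μ(1)⁻¹ ∫ y dμ(y)`. -/
noncomputable def barycenter (μ : Measure ℂ) : ℂ := ⨍ y, y ∂μ

/-- The Choquet order `μ ≺ ν` for measures on a convex compact set `K`: `μ(f) ≤ ν(f)` for every
real continuous convex function `f` on `K`. -/
def ChoquetLE (K : Set ℂ) (μ ν : Measure ℂ) : Prop :=
  ∀ f : ℂ → ℝ, ContinuousOn f K → ConvexOn ℝ K f → ∫ y in K, f y ∂μ ≤ ∫ y in K, f y ∂ν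

/-- A dilation on `K`: a weakly Borel measurable map `x ↦ T x` from `K` to the probability
measures on `K` such that the barycenter of `T x` is `x`. -/
structure IsDilation (K : Set ℂ) (T : K → Measure ℂ) : Prop where
  mem_probOn : ∀ x, T x ∈ probOn K
  barycenter_eq : ∀ x, barycenter (T x) = x
  measurable : ∀ f : ℂ → ℝ, ContinuousOn f K → Measurable fun x : K => ∫ y in K, f y ∂(T x)

/-- `ν = T(μ)`, for measures `μ`, `ν` on `K`: `ν(f) = ∫_K (T x)(f) dμ(x)` for every real
continuous function `f` on `K`. -/
def IsImageUnder (K : Set ℂ) (T : K → Measure ℂ) (μ ν : Measure ℂ) : Prop :=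
  ∀ f : ℂ → ℝ, ContinuousOn f K →
    ∫ y in K, f y ∂ν = ∫ x : K, (∫ y in K, f y ∂(T x)) ∂(μ.comap Subtype.val)

/-- The absolute moment `∫ |w| ^ m dμ(w)`. -/
noncomputable def moment (μ : Measure ℂ) (m : ℕ) : ℝ := ∫ w, ‖w‖ ^ m ∂μ

/-- The logarithmic potential `∫ log |z - w| dμ(w)`, used below only at points `z` at a positive
distance from the support of `μ`. -/
noncomputable def logPotential (μ : Measure ℂ) (z : ℂ) : ℝ := ∫ w, Real.log ‖z - w‖ ∂μ

/-- Weak-* convergence `μ_p → μ` as `p → ∞` inside the set `Γ`. -/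
def WeakStarLim (Γ : Set ℕ) (μs : ℕ → FiniteMeasure ℂ) (μ : FiniteMeasure ℂ) : Prop :=
  Tendsto μs (atTop ⊓ 𝓟 Γ) (𝓝 μ)

end Lame

/-! Write W for the monic multiple of S'. The equation says that V·S is, up to a constant, Q₂W' +
Q₁W, that is Q₂·W times a sum of simple fractions with positive weights over the zeros of W and of
Q₂. The zeros of such a polynomial ∑ bᵢ ∏_{k≠i} (X - αₖ) are the eigenvalues of diag(α) compressed
to the orthogonal complement of the unit vector with entries √(bᵢ/∑b). In a Schur basis of this
complement they are convex combinations of the αᵢ, and by Parseval the column sums of the weights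
are at most 1 (`exists_substochastic_of_roots`). The zeros of S' are in the same way combinations of
those of S.

Thus the zeros of V and of S are convex combinations of the zeros of S and of Q₂. Substituting the
relations for the zeros of S repeatedly pushes the weight onto Q₂; the column bounds force the
weight left on S to drop to at most 1 in total, for every degree n (`exists_absorbed_combination`).
Out of a total weight p - 2 this is negligible, so n(p) may be arbitrary.

The weights define a coupling of μ_V with a measure within O(1/p) of μ_{Q₂}, with exact barycenters
(`exists_approximate_martingale_coupling`). By compactness the limits have a martingale coupling.
Its disintegration is the dilation, and Jensen's inequality gives the Choquet order and the moments.

The function -log|z - w| is not convex in w, so the potentials need another argument: V = Q₂·F·F',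
where F and F' are simple-fraction sums normalized to total weight 1. Seen from z outside the hull,
all poles lie under an angle less than π, so both factors are bounded below independently of p (last
clause of `exists_coupling`). -/

namespace Lame

open scoped InnerProductSpace

/-! ### Schur triangularization -/

/-- A unit vector and an orthonormal basis of its orthogonal complement form an orthonormal
basis. -/
theorem exists_orthonormalBasis_cons {E : Type*} [NormedAddCommGroup E] [InnerProductSpace ℂ E]
    [FiniteDimensional ℂ E] {n : ℕ} (hn : Module.finrank ℂ E = n + 1) (e : E) (he : ‖e‖ = 1)
    (b : OrthonormalBasis (Fin n) ℂ (ℂ ∙ e)ᗮ) :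
    ∃ b' : OrthonormalBasis (Fin (n + 1)) ℂ E, b' 0 = e ∧ ∀ i : Fin n, b' i.succ = b i := by
  let v : Fin (n + 1) → E := Fin.cons e fun i => (b i : E)
  have hv : Orthonormal ℂ v := by
    rw [orthonormal_iff_ite]
    have hb := orthonormal_iff_ite.1 b.orthonormal
    intro i j
    induction i using Fin.cases with
    | zero =>
      induction j using Fin.cases with
      | zero => simp [v, he]
      | succ j =>
        simpa [v, (Fin.succ_ne_zero j).symm] using
          Submodule.mem_orthogonal_singleton_iff_inner_right.1 (b j).2
    | succ i =>
      induction j using Fin.cases with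
      | zero =>
        simpa [v] using Submodule.mem_orthogonal_singleton_iff_inner_left.1 (b i).2
      | succ j => simpa [v] using hb i j
  obtain ⟨b', hb'⟩ := Orthonormal.exists_orthonormalBasis_extension_of_card_eq
    (𝕜 := ℂ) (E := E) (ι := Fin (n + 1)) (by simp [hn]) (v := v) (s := Set.univ)
    (by exact hv.comp _ Subtype.val_injective)
  refine ⟨b', by simpa [v] using hb' 0 trivial, fun i => by simpa [v] using hb' i.succ trivial⟩

/-- Schur triangularization, starting with a prescribed eigenvector of the adjoint. -/
theorem exists_orthonormalBasis_lowerTriangular_of_eigenvector (n : ℕ) :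
    ∀ (E : Type) [NormedAddCommGroup E] [InnerProductSpace ℂ E] [FiniteDimensional ℂ E],
    Module.finrank ℂ E = n + 1 → ∀ (T : E →ₗ[ℂ] E) (e : E) (μ : ℂ), ‖e‖ = 1 →
    (∀ x, ⟪e, T x⟫_ℂ = μ * ⟪e, x⟫_ℂ) →
    ∃ b : OrthonormalBasis (Fin (n + 1)) ℂ E, b 0 = e ∧ ∀ i j, i < j → ⟪b i, T (b j)⟫_ℂ = 0 := by
  induction n with
  | zero =>
    intro E _ _ _ hE T e μ he hT
    have : Fact (Module.finrank ℂ E = 0 + 1) := ⟨hE⟩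
    obtain ⟨b, hb, -⟩ := exists_orthonormalBasis_cons hE e he
      ((stdOrthonormalBasis ℂ (ℂ ∙ e)ᗮ).reindex
        (finCongr (Submodule.finrank_orthogonal_span_singleton (norm_ne_zero_iff.1 (by simp [he])))))
    exact ⟨b, hb, fun i j hij => by omega⟩
  | succ n ih =>
    intro E _ _ _ hE T e μ he hT
    have he0 : e ≠ 0 := norm_ne_zero_iff.1 (by simp [he])
    have : Fact (Module.finrank ℂ E = (n + 1) + 1) := ⟨hE⟩
    have hH : Module.finrank ℂ (ℂ ∙ e)ᗮ = n + 1 := Submodule.finrank_orthogonal_span_singleton he0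
    -- The hypothesis on `e` makes it an eigenvector of the adjoint, so `T` preserves its orthogonal
    -- complement.
    have hinv : ∀ x ∈ (ℂ ∙ e)ᗮ, T x ∈ (ℂ ∙ e)ᗮ := by
      intro x hx
      rw [Submodule.mem_orthogonal_singleton_iff_inner_right] at hx ⊢
      rw [hT, hx, mul_zero]
    let T' := T.restrict hinv
    have : Nontrivial (ℂ ∙ e)ᗮ := Module.nontrivial_of_finrank_pos (R := ℂ) (by omega)
    obtain ⟨ν, hν⟩ := Module.End.exists_eigenvalue (LinearMap.adjoint T')
    obtain ⟨w, hw⟩ := hν.exists_hasEigenvector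
    have hw0 : ‖(w : E)‖ ≠ 0 := by simpa using hw.2
    obtain ⟨b, -, hb⟩ := ih _ hH T' (((‖w‖ : ℂ)⁻¹) • w) (starRingEnd ℂ ν)
      (by rw [norm_smul]; simpa using inv_mul_cancel₀ hw0)
      (by
        intro x
        rw [inner_smul_left, ← LinearMap.adjoint_inner_left, hw.apply_eq_smul, inner_smul_left,
          inner_smul_left]
        ring)
    obtain ⟨b', h0, hs⟩ := exists_orthonormalBasis_cons hE e he b
    refine ⟨b', h0, fun i j hij => ?_⟩
    induction j using Fin.cases with
    | zero => simp at hij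
    | succ j =>
      induction i using Fin.cases with
      | zero =>
        rw [h0, hT, hs, Submodule.mem_orthogonal_singleton_iff_inner_right.1 (b j).2, mul_zero]
      | succ i =>
        rw [hs, hs]
        exact hb i j (Fin.succ_lt_succ_iff.1 hij)

/-! ### Zeros of weighted derivatives as eigenvalues of a compression -/

/-- Two finite families with the same multiset of values agree up to a bijection of the index
types. -/
theorem exists_equiv_of_map_univ_eq {ι κ β : Type*} [Fintype ι] [Fintype κ] {f : ι → β}
    {g : κ → β} (h : (Finset.univ : Finset ι).val.map f = (Finset.univ : Finset κ).val.map g) :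
    ∃ σ : ι ≃ κ, ∀ i, g (σ i) = f i := by
  classical
  have hcard : ∀ c, Nonempty ({i // f i = c} ≃ {j // g j = c}) := by
    intro c
    refine ⟨Fintype.equivOfCardEq ?_⟩
    have := congrArg (Multiset.count c) h
    rw [Multiset.count_map, Multiset.count_map] at this
    rw [Fintype.card_subtype, Fintype.card_subtype, Finset.card_def, Finset.card_def,
      Finset.filter_val, Finset.filter_val]
    simpa only [eq_comm] using this
  exact ⟨Equiv.ofFiberEquiv fun c => (hcard c).some, fun i => Equiv.ofFiberEquiv_map _ _⟩

/-- The characteristic polynomial of a rank one perturbation of a diagonal matrix. -/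
theorem charpoly_diagonal_sub_vecMulVec {ι : Type*} [Fintype ι] [DecidableEq ι]
    (α u w : ι → ℂ) :
    (Matrix.diagonal α - Matrix.vecMulVec u w).charpoly =
      ∏ k, (X - C (α k)) + ∑ i, C (u i * w i) * ∏ k ∈ Finset.univ.erase i, (X - C (α k)) := by
  -- Away from the finitely many `α k` the diagonal part of `z - N` is invertible, and the matrix
  -- determinant lemma applies.
  apply eq_of_infinite_eval_eq
  refine Set.Infinite.mono ?_ ((Set.finite_range α).infinite_compl)
  intro z hz
  have hz' : ∀ k, z - α k ≠ 0 := fun k h => hz ⟨k, (sub_eq_zero.1 h).symm⟩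
  have hdet : (Matrix.diagonal fun k => z - α k).det = ∏ k, (z - α k) := Matrix.det_diagonal
  have hunit : IsUnit (Matrix.diagonal fun k => z - α k).det := by
    rw [hdet]
    exact isUnit_iff_ne_zero.2 (Finset.prod_ne_zero_iff.2 fun k _ => hz' k)
  have hmat : Matrix.scalar ι z - (Matrix.diagonal α - Matrix.vecMulVec u w) =
      (Matrix.diagonal fun k => z - α k) +
        Matrix.replicateCol Unit u * Matrix.replicateRow Unit w := by
    rw [← Matrix.vecMulVec_eq Unit, Matrix.scalar_apply, ← Matrix.diagonal_sub]
    abel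
  have hinv : (Matrix.diagonal fun k => z - α k)⁻¹ = Matrix.diagonal fun k => (z - α k)⁻¹ := by
    apply Matrix.inv_eq_right_inv
    rw [Matrix.diagonal_mul_diagonal]
    simp [hz']
  show eval z _ = eval z _
  rw [Matrix.eval_charpoly, hmat, Matrix.det_add_replicateCol_mul_replicateRow hunit, hdet, hinv,
    Matrix.det_unique]
  have hentry : (1 + ( Matrix.replicateRow Unit w * (Matrix.diagonal fun k => (z - α k)⁻¹) *
      Matrix.replicateCol Unit u) : Matrix Unit Unit ℂ) default default = 1 + ∑ i, w i * (z - α i)⁻¹ * u i := by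
    simp [Matrix.mul_apply, Matrix.diagonal_apply]
  rw [hentry, mul_add, mul_one, Finset.mul_sum]
  simp only [eval_add, eval_prod, eval_sub, eval_X, eval_C, eval_finsetSum, eval_mul]
  congr 1
  refine Finset.sum_congr rfl fun i _ => ?_
  rw [← Finset.mul_prod_erase _ _ (Finset.mem_univ i)]
  field_simp [hz' i]

/-- The characteristic polynomial is the product over the diagonal entries in an orthonormal basis
in which the operator is lower triangular. -/
theorem charpoly_eq_prod_of_lowerTriangular {E : Type*} [NormedAddCommGroup E]
    [InnerProductSpace ℂ E] [FiniteDimensional ℂ E] {n : ℕ} (b : OrthonormalBasis (Fin n) ℂ E)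
    (T : E →ₗ[ℂ] E) (h : ∀ i j, i < j → ⟪b i, T (b j)⟫_ℂ = 0) :
    T.charpoly = ∏ i, (X - C ⟪b i, T (b i)⟫_ℂ) := by
  have hent : ∀ i j, LinearMap.toMatrix b.toBasis b.toBasis T i j = ⟪b i, T (b j)⟫_ℂ := by
    intro i j
    rw [LinearMap.toMatrix_apply, b.coe_toBasis, b.coe_toBasis_repr_apply, b.repr_apply_apply]
  rw [← LinearMap.charpoly_toMatrix T b.toBasis, ← Matrix.charpoly_transpose,
    Matrix.charpoly_of_isUpperTriangular]
  · simp [hent]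
  · intro i j hij
    rw [Matrix.transpose_apply, hent]
    exact h _ _ hij

theorem roots_prod_univ_X_sub_C {ι : Type*} [Fintype ι] (f : ι → ℂ) :
    (∏ i, (X - C (f i))).roots = Finset.univ.val.map f := by
  rw [← roots_multiset_prod_X_sub_C (Finset.univ.val.map f), Multiset.map_map]
  rfl

/-- The roots of `∑ b_i ∏_{k ≠ i} (X - α_k)` with `b_i > 0` are obtained from the `α_i` by a
row-stochastic matrix with column sums at most `1`, and the leading coefficient is `∑ b_i`. -/
theorem exists_substochastic_of_roots {ι κ : Type} [Fintype ι] [DecidableEq ι] [Fintype κ]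
    (α : ι → ℂ) (b : ι → ℝ) (hb : ∀ i, 0 < b i) (r : κ → ℂ) (c : ℂ) (hc : c ≠ 0)
    (h : C c * ∏ j, (X - C (r j)) =
      ∑ i, C (b i : ℂ) * ∏ k ∈ Finset.univ.erase i, (X - C (α k))) :
    c = ∑ i, (b i : ℂ) ∧ ∃ M : κ → ι → ℝ, (∀ j i, 0 ≤ M j i) ∧ (∀ j, ∑ i, M j i = 1) ∧ (∀ i, ∑ j, M j i ≤ 1) ∧
      ∀ j, r j = ∑ i, (M j i : ℂ) * α i := by
  classical
  have hι : Nonempty ι := by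
    by_contra hι
    rw [not_nonempty_iff] at hι
    rw [Fintype.sum_empty] at h
    exact mul_ne_zero (C_ne_zero.2 hc) (Finset.prod_ne_zero_iff.2 fun j _ => X_sub_C_ne_zero _) h
  have hB : 0 < ∑ i, b i := Finset.sum_pos (fun i _ => hb i) Finset.univ_nonempty
  set B := ∑ i, b i with hBdef
  let e : EuclideanSpace ℂ ι := WithLp.toLp 2 fun i => ((√(b i / B) : ℝ) : ℂ)
  have hee : ∀ i, e i * e i = ((b i / B : ℝ) : ℂ) := by
    intro i
    show ((√(b i / B) : ℝ) : ℂ) * ((√(b i / B) : ℝ) : ℂ) = _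
    rw [← Complex.ofReal_mul, Real.mul_self_sqrt (div_nonneg (hb i).le hB.le)]
  have hconj : ∀ i, (starRingEnd ℂ) (e i) = e i := fun i => Complex.conj_ofReal _
  have hnorm : ‖e‖ = 1 := by
    have : ‖e‖ ^ 2 = 1 := by
      rw [EuclideanSpace.norm_sq_eq, ← div_self hB.ne', hBdef, Finset.sum_div]
      refine Finset.sum_congr rfl fun i _ => ?_
      rw [← Complex.ofReal_inj, ← hee i, ← Complex.normSq_eq_norm_sq, ← Complex.mul_conj, hconj]
    exact (pow_eq_one_iff_of_nonneg (norm_nonneg e) two_ne_zero).1 this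
  -- `N` is (1 - e e*)·diag(α): its range is orthogonal to `e`, and on the complement of `e` it is
  -- the compression of diag(α).
  let N : Matrix ι ι ℂ := Matrix.diagonal α - Matrix.vecMulVec e fun i => e i * α i
  let T : EuclideanSpace ℂ ι →ₗ[ℂ] EuclideanSpace ℂ ι := Matrix.toLpLin 2 2 N
  have hTapp : ∀ x i, T x i = α i * x i - e i * ∑ k, e k * α k * x k := by
    intro x i
    simp [T, N, Matrix.mulVec_diagonal, Matrix.vecMulVec_mulVec, dotProduct]
  have hinner : ∀ x y : EuclideanSpace ℂ ι, ⟪x, T y⟫_ℂ =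
      ∑ i, α i * y i * (starRingEnd ℂ) (x i) - ⟪x, e⟫_ℂ * ∑ k, e k * α k * y k := by
    intro x y
    rw [PiLp.inner_apply, PiLp.inner_apply, Finset.sum_mul, ← Finset.sum_sub_distrib]
    refine Finset.sum_congr rfl fun i _ => ?_
    rw [RCLike.inner_apply, RCLike.inner_apply, hTapp]
    ring
  have hTe : ∀ y, ⟪e, T y⟫_ℂ = 0 := by
    intro y
    rw [hinner, inner_self_eq_norm_sq_to_K, hnorm]
    simp only [hconj, Complex.coe_algebraMap, Complex.ofReal_one, one_pow, one_mul]
    rw [sub_eq_zero]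
    exact Finset.sum_congr rfl fun i _ => by ring
  obtain ⟨n, hn⟩ : ∃ n, Fintype.card ι = n + 1 :=
    ⟨Fintype.card ι - 1, by have := Fintype.card_pos (α := ι); omega⟩
  obtain ⟨v, hv0, hv⟩ := exists_orthonormalBasis_lowerTriangular_of_eigenvector n
    (EuclideanSpace ℂ ι) (by simp [hn]) T e 0 hnorm (by simpa using hTe)
  have hdiag : ∀ i : Fin n, ⟪v i.succ, T (v i.succ)⟫_ℂ = ∑ k, (‖v i.succ k‖ ^ 2 : ℝ) * α k := by
    intro i
    rw [hinner, ← hv0, v.orthonormal.2 (Fin.succ_ne_zero i), zero_mul, sub_zero]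
    refine Finset.sum_congr rfl fun k _ => ?_
    rw [mul_assoc, Complex.mul_conj, Complex.normSq_eq_norm_sq]
    ring
  have hchar : T.charpoly = N.charpoly := by
    rw [← LinearMap.charpoly_toMatrix T (PiLp.basisFun 2 ℂ ι)]
    congr 1
    simp [T, Matrix.toLpLin_eq_toLin]
  -- In each term of the characteristic polynomial (X - αᵢ) + αᵢ = X; this factor X is the
  -- eigenvalue 0 belonging to `e`.
  have hcp : C (B : ℂ) * T.charpoly = X * (C c * ∏ j, (X - C (r j))) := by
    rw [hchar, charpoly_diagonal_sub_vecMulVec, h, mul_add, Finset.mul_sum, Finset.mul_sum]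
    have : C (B : ℂ) * ∏ k, (X - C (α k)) =
        ∑ i, C (b i : ℂ) * ((X - C (α i)) * ∏ k ∈ Finset.univ.erase i, (X - C (α k))) := by
      rw [hBdef, Complex.ofReal_sum, map_sum, Finset.sum_mul]
      exact Finset.sum_congr rfl fun i _ => by
        rw [Finset.mul_prod_erase _ (fun k => X - C (α k)) (Finset.mem_univ i)]
    rw [this, ← Finset.sum_add_distrib]
    refine Finset.sum_congr rfl fun i _ => ?_
    have hi : (B : ℂ) * (e i * (e i * α i)) = b i * α i := by
      rw [← mul_assoc (e i), hee, Complex.ofReal_div]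
      field_simp [Complex.ofReal_ne_zero.2 hB.ne']
    rw [← mul_assoc (C (B : ℂ)), ← C_mul, hi, C_mul]
    ring
  have hlead : c = B := by
    have := congrArg leadingCoeff hcp
    simpa [leadingCoeff_mul, leadingCoeff_prod, (LinearMap.charpoly_monic T).leadingCoeff]
      using this.symm
  rw [charpoly_eq_prod_of_lowerTriangular v T hv, Fin.prod_univ_succ, hv0, hTe, C_0, sub_zero,
    mul_left_comm] at hcp
  have hroots := congrArg roots (mul_left_cancel₀ X_ne_zero hcp)
  rw [roots_C_mul _ hc, roots_C_mul _ (Complex.ofReal_ne_zero.2 hB.ne')] at hroots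
  rw [roots_prod_univ_X_sub_C, roots_prod_univ_X_sub_C] at hroots
  obtain ⟨σ, hσ⟩ := exists_equiv_of_map_univ_eq hroots.symm
  -- Rows sum to 1 because the basis vectors are unit vectors. Parseval for the i-th coordinate
  -- vector bounds the columns: only the term of `v 0 = e` is missing.
  refine ⟨by rw [hlead, hBdef, Complex.ofReal_sum], fun j i => ‖v (σ j).succ i‖ ^ 2, fun j i => by positivity,
    fun j => ?_, fun i => ?_, fun j => ?_⟩
  · rw [← EuclideanSpace.norm_sq_eq, v.orthonormal.1, one_pow]
  · rw [σ.sum_comp fun j => ‖v j.succ i‖ ^ 2]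
    have := v.sum_sq_norm_inner_left (EuclideanSpace.single i 1)
    simp only [EuclideanSpace.inner_single_left, map_one, one_mul] at this
    rw [PiLp.norm_single, norm_one, one_pow, Fin.sum_univ_succ] at this
    nlinarith [sq_nonneg ‖v 0 i‖]
  · rw [← hσ, hdiag]

/-! ### Eliminating the zeros of the Heine–Stieltjes polynomial -/

/-- Elimination of the intermediate points `s` from a system of convex combinations
`v = A s + B q`, `s = C s + D q` whose columns sum to at most `1`: up to a total mass of at most
`1`, the points `v` are convex combinations of the `q` alone, again with column sums at most `1`. -/
theorem exists_absorbed_combination {κ σ τ : Type*} [Fintype κ] [Fintype σ] [Fintype τ]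
    (A : κ → σ → ℝ) (B : κ → τ → ℝ) (C : σ → σ → ℝ) (D : σ → τ → ℝ)
    (hA : ∀ i j, 0 ≤ A i j) (hB : ∀ i j, 0 ≤ B i j) (hC : ∀ i j, 0 ≤ C i j)
    (hD : ∀ i j, 0 ≤ D i j)
    (hAB : ∀ i, ∑ s, A i s + ∑ t, B i t = 1) (hCD : ∀ i, ∑ s, C i s + ∑ t, D i t = 1)
    (hAC : ∀ s, ∑ i, A i s + ∑ s', C s' s ≤ 1) (hBD : ∀ t, ∑ i, B i t + ∑ s, D s t ≤ 1)
    (v : κ → ℂ) (s : σ → ℂ) (q : τ → ℂ)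
    (hv : ∀ i, v i = ∑ j, (A i j : ℂ) * s j + ∑ t, (B i t : ℂ) * q t)
    (hs : ∀ i, s i = ∑ j, (C i j : ℂ) * s j + ∑ t, (D i t : ℂ) * q t) :
    ∃ (H : κ → τ → ℝ) (R : κ → σ → ℝ), (∀ i t, 0 ≤ H i t) ∧ (∀ i j, 0 ≤ R i j) ∧
      (∀ i, ∑ j, R i j + ∑ t, H i t = 1) ∧ (∀ t, ∑ i, H i t ≤ 1) ∧ (∑ i, ∑ j, R i j ≤ 1) ∧
      ∀ i, v i = ∑ j, (R i j : ℂ) * s j + ∑ t, (H i t : ℂ) * q t := by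
  -- After k substitutions R = A Cᵏ is the weight still on `s`, `O` sums the column sums of all
  -- earlier R, and E = 1ᵀCᵏ is the capacity left; the process stops once R has total mass at most
  -- 1. Since `O + E ≤ 1`, no `s j` ever carries more than unit mass, which also bounds the columns
  -- of `H`.
  have key : ∀ k : ℕ, ∃ (H : κ → τ → ℝ) (R : κ → σ → ℝ) (O E : σ → ℝ),
      (∀ i t, 0 ≤ H i t) ∧ (∀ i j, 0 ≤ R i j) ∧ (∀ j, 0 ≤ E j) ∧
      (∀ i, ∑ j, R i j + ∑ t, H i t = 1) ∧
      (∀ i, v i = ∑ j, (R i j : ℂ) * s j + ∑ t, (H i t : ℂ) * q t) ∧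
      (∀ t, ∑ i, H i t ≤ ∑ i, B i t + ∑ j, O j * D j t) ∧
      (∀ j, ∑ j', E j' * C j' j + ∑ i, R i j ≤ E j) ∧ (∀ j, O j + E j ≤ 1) ∧
      ((k : ℝ) ≤ ∑ j, O j ∨ ∑ i, ∑ j, R i j ≤ 1) := by
    intro k
    induction k with
    | zero =>
      refine ⟨B, A, fun _ => 0, fun _ => 1, hB, hA, fun _ => zero_le_one, hAB, hv, ?_, ?_, ?_, ?_⟩
      · simp
      · intro j
        have := hAC j
        simp only [one_mul]
        linarith
      · simp
      · simp
    | succ k ih =>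
      obtain ⟨H, R, O, E, hH, hR, hE, hrow, hbar, hcol, hER, hOE, hk⟩ := ih
      by_cases hdone : ∑ i, ∑ j, R i j ≤ 1
      · exact ⟨H, R, O, E, hH, hR, hE, hrow, hbar, hcol, hER, hOE, Or.inr hdone⟩
      have hk := hk.resolve_right hdone
      refine ⟨fun i t => H i t + ∑ j, R i j * D j t, fun i j => ∑ j', R i j' * C j' j,
        fun j => O j + ∑ i, R i j, fun j => ∑ j', E j' * C j' j, ?_, ?_, ?_, ?_, ?_, ?_, ?_, ?_, ?_⟩
      · exact fun i t => add_nonneg (hH i t)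
          (Finset.sum_nonneg fun j _ => mul_nonneg (hR i j) (hD j t))
      · exact fun i j => Finset.sum_nonneg fun j' _ => mul_nonneg (hR i j') (hC j' j)
      · exact fun j => Finset.sum_nonneg fun j' _ => mul_nonneg (hE j') (hC j' j)
      · intro i
        rw [← hrow i, Finset.sum_comm, Finset.sum_add_distrib,
          Finset.sum_comm (f := fun t j => R i j * D j t), add_comm (∑ t, H i t), ← add_assoc,
          ← Finset.sum_add_distrib]
        congr 1
        refine Finset.sum_congr rfl fun j _ => ?_
        rw [← Finset.mul_sum, ← Finset.mul_sum, ← mul_add, hCD, mul_one]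
      · intro i
        rw [hbar i]
        simp only [Complex.ofReal_sum, Complex.ofReal_add, Complex.ofReal_mul, add_mul,
          Finset.sum_add_distrib, Finset.sum_mul]
        rw [Finset.sum_comm (f := fun j j' => (R i j' : ℂ) * (C j' j : ℂ) * s j),
          Finset.sum_comm (f := fun t j => (R i j : ℂ) * (D j t : ℂ) * q t), add_comm (∑ t, _ * q t),
          ← add_assoc, ← Finset.sum_add_distrib]
        congr 1
        refine Finset.sum_congr rfl fun j _ => ?_
        conv_lhs => rw [hs j]
        rw [mul_add, Finset.mul_sum, Finset.mul_sum]
        simp only [mul_assoc]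
      · intro t
        simp only [Finset.sum_add_distrib, add_mul, Finset.sum_mul]
        rw [Finset.sum_comm (f := fun i j => R i j * D j t)]
        linarith [hcol t]
      · intro j
        rw [Finset.sum_comm]
        simp only [← Finset.sum_mul]
        rw [← Finset.sum_add_distrib]
        refine Finset.sum_le_sum fun j' _ => ?_
        rw [← add_mul]
        exact mul_le_mul_of_nonneg_right (hER j') (hC j' j)
      · intro j
        linarith [hER j, hOE j]
      · left
        rw [Finset.sum_add_distrib, Finset.sum_comm (f := fun j i => R i j)]
        push_cast
        linarith
  -- Every step that starts with residual mass above 1 adds more than 1 to ∑ O, while ∑ O never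
  -- exceeds the number of points `s`.
  obtain ⟨H, R, O, E, hH, hR, hE, hrow, hbar, hcol, hER, hOE, hk⟩ := key (Fintype.card σ + 1)
  have hO : ∀ j, O j ≤ 1 := fun j => by linarith [hOE j, hE j]
  refine ⟨H, R, hH, hR, hrow, fun t => ?_, ?_, hbar⟩
  · have : ∑ j, O j * D j t ≤ ∑ j, D j t :=
      Finset.sum_le_sum fun j _ => mul_le_of_le_one_left (hD j t) (hO j)
    linarith [hcol t, hBD t]
  · refine hk.resolve_left fun hk => ?_
    have : ∑ j, O j ≤ ∑ _j : σ, (1 : ℝ) := Finset.sum_le_sum fun j _ => hO j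
    simp only [Finset.sum_const, Finset.card_univ, nsmul_eq_mul, mul_one] at this
    push_cast at hk
    linarith

/-! ### Products of linear factors and partial fractions -/

/-- A complex polynomial of degree `d` is the product of its leading coefficient and `d` linear
factors. -/
theorem exists_eq_C_mul_prod {P : ℂ[X]} {d : ℕ} (hd : P.natDegree = d) :
    ∃ f : Fin d → ℂ, P = C P.leadingCoeff * ∏ i, (X - C (f i)) := by
  have hs := IsAlgClosed.splits P
  obtain ⟨l, hl⟩ : ∃ l : List ℂ, P.roots = l := ⟨P.roots.toList, by simp⟩
  have hlen : l.length = d := by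
    rw [← hd, hs.natDegree_eq_card_roots, hl, Multiset.coe_card]
  subst hlen
  refine ⟨l.get, ?_⟩
  conv_lhs => rw [hs.eq_prod_roots, hl]
  congr 1
  rw [Finset.prod, ← Function.comp_def (fun a => X - C a) l.get, ← Multiset.map_map,
    Fin.univ_val_map, List.ofFn_get]

theorem prod_X_sub_C_eval_ne_zero {ι : Type*} [Fintype ι] {f : ι → ℂ} {z : ℂ}
    (hz : ∀ i, z ≠ f i) : (∏ i, (X - C (f i))).eval z ≠ 0 := by
  rw [eval_prod]
  exact Finset.prod_ne_zero_iff.2 fun i _ => by simpa using sub_ne_zero.2 (hz i)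

theorem eval_sum_C_mul_prod_erase {ι : Type*} [Fintype ι] [DecidableEq ι] (f : ι → ℂ) (b : ι → ℝ)
    {z : ℂ} (hz : ∀ i, z ≠ f i) :
    (∑ i, C (b i : ℂ) * ∏ k ∈ Finset.univ.erase i, (X - C (f k))).eval z =
      (∏ i, (X - C (f i))).eval z * ∑ i, (b i : ℂ) / (z - f i) := by
  rw [eval_finsetSum, Finset.mul_sum]
  refine Finset.sum_congr rfl fun i _ => ?_
  rw [← Finset.mul_prod_erase _ (fun k => X - C (f k)) (Finset.mem_univ i)]
  have := sub_ne_zero.2 (hz i)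
  simp only [eval_mul, eval_sub, eval_X, eval_C]
  field_simp

theorem derivative_prod_X_sub_C {ι : Type*} [Fintype ι] [DecidableEq ι] (f : ι → ℂ) :
    derivative (∏ i, (X - C (f i))) =
      ∑ i, C ((1 : ℝ) : ℂ) * ∏ k ∈ Finset.univ.erase i, (X - C (f k)) := by
  rw [derivative_prod_finset]
  simp

theorem eq_sum_of_forall_div_eq {ι : Type*} [Fintype ι] [DecidableEq ι] (f : ι → ℂ) (b : ι → ℝ)
    (Q : ℂ[X]) (h : ∀ z : ℂ, (∏ i, (X - C (f i))).eval z ≠ 0 →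
      Q.eval z / (∏ i, (X - C (f i))).eval z = ∑ i, (b i : ℂ) / (z - f i)) :
    Q = ∑ i, C (b i : ℂ) * ∏ k ∈ Finset.univ.erase i, (X - C (f k)) := by
  apply eq_of_infinite_eval_eq
  refine Set.Infinite.mono ?_ ((Set.finite_range f).infinite_compl)
  intro z hz
  have hz' : ∀ k, z ≠ f k := fun k h => hz ⟨k, h.symm⟩
  have h0 := prod_X_sub_C_eval_ne_zero hz'
  show eval z _ = eval z _
  rw [eval_sum_C_mul_prod_erase f b hz', ← h z h0, mul_div_cancel₀ _ h0]

/-- This brings Q₂W' + Q₁W into the form required by `exists_substochastic_of_roots`, with `f` the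
zeros of W (weights 1) and `g` those of Q₂ (weights `a`). -/
theorem prod_mul_sum_add_sum_mul_prod {ι κ : Type*} [Fintype ι] [DecidableEq ι] [Fintype κ]
    [DecidableEq κ] (f : ι → ℂ) (g : κ → ℂ) (b : ι → ℝ) (d : κ → ℝ) :
    (∏ k, (X - C (g k))) * (∑ i, C (b i : ℂ) * ∏ k ∈ Finset.univ.erase i, (X - C (f k))) +
      (∑ i, C (d i : ℂ) * ∏ k ∈ Finset.univ.erase i, (X - C (g k))) * ∏ i, (X - C (f i)) =
    ∑ x : ι ⊕ κ, C ((Sum.elim b d x : ℝ) : ℂ) *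
      ∏ y ∈ Finset.univ.erase x, (X - C (Sum.elim f g y)) := by
  have h1 : ∀ i : ι, (Finset.univ : Finset (ι ⊕ κ)).erase (Sum.inl i) =
      (Finset.univ.erase i).disjSum Finset.univ := by
    intro i; ext x; cases x <;> simp
  have h2 : ∀ i : κ, (Finset.univ : Finset (ι ⊕ κ)).erase (Sum.inr i) =
      Finset.univ.disjSum (Finset.univ.erase i) := by
    intro i; ext x; cases x <;> simp
  rw [Fintype.sum_sum_type, Finset.mul_sum, Finset.sum_mul]
  congr 1
  · refine Finset.sum_congr rfl fun i _ => ?_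
    rw [h1, Finset.prod_disjSum]
    simp only [Sum.elim_inl, Sum.elim_inr]
    ring
  · refine Finset.sum_congr rfl fun i _ => ?_
    rw [h2, Finset.prod_disjSum]
    simp only [Sum.elim_inl, Sum.elim_inr]
    ring

/-! ### Half-plane arguments and the location of zeros -/

/-- With φ(x) = Re(e·x̄), separation by a functional becomes a sign condition on simple fractions.
-/
theorem exists_re_div_eq (φ : ℂ →L[ℝ] ℝ) :
    ∃ e : ℂ, ∀ x : ℂ, (e / x).re = φ x / Complex.normSq x := by
  refine ⟨φ 1 + φ Complex.I * Complex.I, fun x => ?_⟩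
  have hlin : φ x = x.re * φ 1 + x.im * φ Complex.I := by
    conv_lhs => rw [← Complex.re_add_im x]
    rw [map_add, ← mul_one (x.re : ℂ), ← Complex.real_smul, ← Complex.real_smul, map_smul,
      map_smul, smul_eq_mul, smul_eq_mul]
  rw [hlin, Complex.div_re]
  simp
  ring

/-- A point outside of a compact convex set sees this set under an angle less than `π`. -/
theorem exists_le_re_div {L : Set ℂ} (hL : Convex ℝ L) (hLc : IsCompact L) {z : ℂ} (hz : z ∉ L) :
    ∃ (e : ℂ) (η : ℝ), ‖e‖ ≤ 1 ∧ 0 < η ∧ ∀ x ∈ L, η ≤ (e / (z - x)).re := by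
  obtain ⟨φ, u, hφL, hφz⟩ := geometric_hahn_banach_closed_point hL hLc.isClosed hz
  obtain ⟨e, he⟩ := exists_re_div_eq φ
  have hne : ∀ x ∈ L, z - x ≠ 0 := fun x hx h => hz (by rwa [sub_eq_zero.1 h])
  have hpos : (0 : ℝ) < ‖e‖ + 1 := by positivity
  -- The summand 1 avoids a case distinction for `e = 0`.
  refine ⟨((‖e‖ + 1)⁻¹ : ℝ) * e, ?_⟩
  have hpt : ∀ x ∈ L, 0 < ((((‖e‖ + 1)⁻¹ : ℝ) : ℂ) * e / (z - x)).re := by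
    intro x hx
    rw [mul_div_assoc, Complex.re_ofReal_mul, he, map_sub]
    exact mul_pos (inv_pos.2 hpos) (div_pos (by linarith [hφL x hx])
      (Complex.normSq_pos.2 (hne x hx)))
  have hnorm : ‖(((‖e‖ + 1)⁻¹ : ℝ) : ℂ) * e‖ ≤ 1 := by
    rw [norm_mul, Complex.norm_real, Real.norm_of_nonneg (inv_nonneg.2 hpos.le),
      inv_mul_le_one₀ hpos]
    linarith
  rcases L.eq_empty_or_nonempty with rfl | hne'
  · exact ⟨1, hnorm, one_pos, fun x hx => absurd hx (Set.notMem_empty x)⟩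
  · have hcont : ContinuousOn (fun x => ((((‖e‖ + 1)⁻¹ : ℝ) : ℂ) * e / (z - x)).re) L :=
      Complex.continuous_re.comp_continuousOn
        (continuousOn_const.div (continuousOn_const.sub continuousOn_id) hne)
    obtain ⟨m, hm, hmin⟩ := hLc.exists_isMinOn hne' hcont
    exact ⟨_, hnorm, hpt m hm, fun x hx => hmin hx⟩

/-- The zeros of a Heine-Stieltjes polynomial lie in every closed convex set that contains the
points `ζ`. -/
theorem root_mem_of_lame {ι κ : Type*} [Fintype ι] [DecidableEq ι] [Fintype κ] [DecidableEq κ]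
    [Nonempty ι] (ζ : ι → ℂ) (a : ι → ℝ) (ha : ∀ i, 0 < a i) (s : κ → ℂ) (V : ℂ[X])
    (h : (∏ i, (X - C (ζ i))) * derivative (derivative (∏ k, (X - C (s k)))) +
      (∑ i, C (a i : ℂ) * ∏ j ∈ Finset.univ.erase i, (X - C (ζ j))) *
        derivative (∏ k, (X - C (s k))) + V * ∏ k, (X - C (s k)) = 0)
    {L : Set ℂ} (hL : Convex ℝ L) (hLc : IsClosed L) (hζ : ∀ i, ζ i ∈ L) (k : κ) : s k ∈ L := by
  by_contra hk
  obtain ⟨φ, u, hφL, hφk⟩ := geometric_hahn_banach_closed_point hL hLc hk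
  -- At a zero extremal for `φ`, all other zeros and all `ζ` lie on one side, so the fractions in
  -- the equilibrium equation `hzero` cannot cancel.
  obtain ⟨m, -, hm⟩ := Finset.exists_max_image Finset.univ (fun j => φ (s j)) ⟨k, Finset.mem_univ k⟩
  have hmu : ∀ i, φ (ζ i) < φ (s m) := fun i =>
    (hφL _ (hζ i)).trans (hφk.trans_le (hm k (Finset.mem_univ k)))
  have hne : ∀ i, s m ≠ ζ i := fun i hi => (hmu i).ne (by rw [hi])
  obtain ⟨e, he⟩ := exists_re_div_eq φ
  set P := ∏ k, (X - C (s k)) with hP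
  set Q := ∏ i, (X - C (ζ i)) with hQ
  set G := ∏ j ∈ Finset.univ.erase m, (X - C (s j)) with hG
  have hPG : P = (X - C (s m)) * G :=
    (Finset.mul_prod_erase _ (fun j => X - C (s j)) (Finset.mem_univ m)).symm
  have hQ0 : Q.eval (s m) ≠ 0 := prod_X_sub_C_eval_ne_zero hne
  have hP0 : P ≠ 0 := Finset.prod_ne_zero_iff.2 fun j _ => X_sub_C_ne_zero _
  have hroot : P.IsRoot (s m) := by simp [hPG]
  -- The zero is simple: if S vanished to order k ≥ 2 there, S'' would vanish only to order k - 2,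
  -- whereas the equation with Q₂ ≠ 0 forces order at least k - 1.
  have hG0 : G.eval (s m) ≠ 0 := by
    intro hG0
    have hd1 : (derivative P).IsRoot (s m) := by simp [hPG, hG0]
    have h1 : 1 < P.rootMultiplicity (s m) :=
      (one_lt_rootMultiplicity_iff_isRoot hP0).2 ⟨hroot, hd1⟩
    have hm1 := derivative_rootMultiplicity_of_root hroot
    have hm2 := derivative_rootMultiplicity_of_root hd1
    have hdvd : (X - C (s m)) ^ ((derivative P).rootMultiplicity (s m)) ∣
        Q * derivative (derivative P) := by
      have hrw : Q * derivative (derivative P) = -((∑ i, C (a i : ℂ) *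
          ∏ j ∈ Finset.univ.erase i, (X - C (ζ j))) * derivative P + V * P) := by
        linear_combination h
      rw [hrw, dvd_neg]
      refine dvd_add (Dvd.dvd.mul_left (pow_rootMultiplicity_dvd _ _) _) (Dvd.dvd.mul_left ?_ _)
      exact (pow_dvd_pow _ (by omega)).trans (pow_rootMultiplicity_dvd P _)
    have hcop : IsCoprime ((X - C (s m)) ^ ((derivative P).rootMultiplicity (s m))) Q := by
      refine IsCoprime.pow_left ((irreducible_X_sub_C _).coprime_iff_not_dvd.2 ?_)
      rwa [dvd_iff_isRoot]
    have hdd : derivative (derivative P) ≠ 0 := by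
      intro h0
      have hd : (derivative P).natDegree = 0 := derivative_eq_zero.1 h0
      obtain ⟨x, hx⟩ := natDegree_eq_zero.1 hd
      have hx0 : x = 0 := by simpa [← hx] using hd1
      have : P.natDegree = 0 := derivative_eq_zero.1 (by rw [← hx, hx0, C_0])
      rw [eq_C_of_natDegree_eq_zero this, IsRoot, eval_C] at hroot
      exact hP0 (by rw [eq_C_of_natDegree_eq_zero this, hroot, C_0])
    have := (le_rootMultiplicity_iff hdd).2 (hcop.dvd_of_dvd_mul_left hdvd)
    omega
  have hG' : eval (s m) (derivative G) * e = G.eval (s m) *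
      ∑ j ∈ Finset.univ.erase m, e / (s m - s j) := by
    have hz : ∀ j ∈ Finset.univ.erase m, s m - s j ≠ 0 := by
      rw [hG, eval_prod] at hG0
      intro j hj
      simpa using Finset.prod_ne_zero_iff.1 hG0 j hj
    rw [hG, derivative_prod_finset, eval_finsetSum, Finset.sum_mul, Finset.mul_sum]
    refine Finset.sum_congr rfl fun j hj => ?_
    rw [← Finset.mul_prod_erase _ (fun j => X - C (s j)) hj]
    simp only [derivative_sub, derivative_X, derivative_C, sub_zero, mul_one, eval_mul, eval_sub,
      eval_X, eval_C]
    field_simp [hz j hj]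
  have hev := congrArg (eval (s m)) h
  have hP1 : eval (s m) (derivative P) = G.eval (s m) := by simp [hPG]
  have hP2 : eval (s m) (derivative (derivative P)) = 2 * eval (s m) (derivative G) := by
    simp [hPG]
    ring
  rw [eval_add, eval_add, eval_mul, eval_mul, eval_mul, eval_sum_C_mul_prod_erase ζ a hne,
    hP1, hP2, hroot.eq_zero, mul_zero, add_zero, eval_zero, ← hQ] at hev
  have hzero : 2 * (∑ j ∈ Finset.univ.erase m, e / (s m - s j)) +
      ∑ i, (a i : ℂ) * (e / (s m - ζ i)) = 0 := by
    have : Q.eval (s m) * G.eval (s m) * (2 * (∑ j ∈ Finset.univ.erase m, e / (s m - s j)) +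
        ∑ i, (a i : ℂ) * (e / (s m - ζ i))) = 0 := by
      have h3 : ∑ i, (a i : ℂ) * (e / (s m - ζ i)) = (∑ i, (a i : ℂ) / (s m - ζ i)) * e := by
        rw [Finset.sum_mul]
        exact Finset.sum_congr rfl fun i _ => by ring
      rw [h3]
      linear_combination e * hev - 2 * Q.eval (s m) * hG'
    exact (mul_eq_zero.1 this).resolve_left (mul_ne_zero hQ0 hG0)
  have hre := congrArg Complex.re hzero
  rw [Complex.add_re, Complex.re_sum, Complex.mul_re, Complex.re_sum] at hre
  simp only [Complex.re_ofReal_mul, he, map_sub, Complex.re_ofNat, Complex.im_ofNat, zero_mul, sub_zero,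
    Complex.zero_re] at hre
  have h1 : 0 ≤ ∑ j ∈ Finset.univ.erase m, (φ (s m) - φ (s j)) / Complex.normSq (s m - s j) :=
    Finset.sum_nonneg fun j _ =>
      div_nonneg (sub_nonneg.2 (hm j (Finset.mem_univ j))) (Complex.normSq_nonneg _)
  have h2 : 0 < ∑ i, a i * ((φ (s m) - φ (ζ i)) / Complex.normSq (s m - ζ i)) :=
    Finset.sum_pos (fun i _ => mul_pos (ha i) (div_pos (sub_pos.2 (hmu i))
      (Complex.normSq_pos.2 (sub_ne_zero.2 (hne i))))) Finset.univ_nonempty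
  linarith

/-- A lower bound for a sum of simple fractions with poles in a set that is seen from `z` under an
angle less than `π`. -/
theorem le_norm_sum_div {ι : Type*} [Fintype ι] (f : ι → ℂ) (b : ι → ℝ) (hb : ∀ i, 0 < b i)
    {z e : ℂ} {η : ℝ} (he : ‖e‖ ≤ 1) (h : ∀ i, η ≤ (e / (z - f i)).re) :
    (∑ i, b i) * η ≤ ‖∑ i, (b i : ℂ) / (z - f i)‖ := by
  calc (∑ i, b i) * η ≤ ∑ i, b i * (e / (z - f i)).re := by
        rw [Finset.sum_mul]
        exact Finset.sum_le_sum fun i _ => mul_le_mul_of_nonneg_left (h i) (hb i).le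
    _ = (e * ∑ i, (b i : ℂ) / (z - f i)).re := by
        rw [Finset.mul_sum, Complex.re_sum]
        refine Finset.sum_congr rfl fun i _ => ?_
        rw [← Complex.re_ofReal_mul]
        congr 1
        ring
    _ ≤ ‖e * ∑ i, (b i : ℂ) / (z - f i)‖ := Complex.re_le_norm _
    _ ≤ ‖∑ i, (b i : ℂ) / (z - f i)‖ := by
        rw [norm_mul]
        exact mul_le_of_le_one_left (norm_nonneg _) he

/-! ### Convex combinations and a lower bound for a single Van Vleck polynomial -/

/-- The zeros of a Van Vleck polynomial are, up to a total mass of at most `1`, convex combinations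
of the zeros of `Q₂` with column sums at most `1`, and outside of the convex hull it is bounded from
below by a multiple of `Q₂`. -/
theorem exists_coupling {p n : ℕ} (hp : 2 ≤ p) (hn : 1 ≤ n) {Q₂ Q₁ V S : ℂ[X]} {c : ℂ}
    (hQ : IsAdmissiblePair p Q₂ Q₁) (hS : S.Monic) (hSn : S.natDegree = n) (hV : V.Monic)
    (hVn : V.natDegree = p - 2) (hc : c ≠ 0) (hSV : IsSpectralPair p n Q₂ Q₁ (C c * V) S)
    {L : Set ℂ} (hL : Convex ℝ L) (hLc : IsClosed L) (hζL : ∀ z, Q₂.IsRoot z → z ∈ L) :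
    ∃ (ζ : Fin p → ℂ) (v : Fin (p - 2) → ℂ) (s : Fin n → ℂ) (H : Fin (p - 2) → Fin p → ℝ)
      (R : Fin (p - 2) → Fin n → ℝ),
      Q₂ = ∏ i, (X - C (ζ i)) ∧ V = ∏ i, (X - C (v i)) ∧ (∀ i, v i ∈ L) ∧ (∀ i, s i ∈ L) ∧
      (∀ i t, 0 ≤ H i t) ∧ (∀ i j, 0 ≤ R i j) ∧
      (∀ i, ∑ j, R i j + ∑ t, H i t = 1) ∧ (∀ t, ∑ i, H i t ≤ 1) ∧ (∑ i, ∑ j, R i j ≤ 1) ∧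
      (∀ i, v i = ∑ j, (R i j : ℂ) * s j + ∑ t, (H i t : ℂ) * ζ t) ∧
      ∀ (z e : ℂ) (η : ℝ), ‖e‖ ≤ 1 → 0 < η → (∀ x ∈ L, η ≤ (e / (z - x)).re) →
        η ^ 2 * ‖Q₂.eval z‖ ≤ ‖V.eval z‖ := by
  obtain ⟨ζ, a, ha, hQ₂, hQ₁⟩ := hQ
  obtain ⟨-, -, hode⟩ := hSV
  rw [hQ₂] at hQ₁
  replace hQ₁ := eq_sum_of_forall_div_eq ζ a Q₁ hQ₁
  have hζ : ∀ i, ζ i ∈ L := fun i => hζL _ <| by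
    rw [hQ₂, IsRoot, eval_prod]
    exact Finset.prod_eq_zero (Finset.mem_univ i) (by simp)
  obtain ⟨v, hv⟩ := exists_eq_C_mul_prod hVn
  obtain ⟨s, hs⟩ := exists_eq_C_mul_prod hSn
  rw [hV.leadingCoeff, C_1, one_mul] at hv
  rw [hS.leadingCoeff, C_1, one_mul] at hs
  have hpos : Nonempty (Fin p) := ⟨⟨0, by omega⟩⟩
  have hsL : ∀ i, s i ∈ L := by
    refine root_mem_of_lame ζ a ha s (C c * V) ?_ hL hLc hζ
    rw [← hs, ← hQ₂, ← hQ₁, hode]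
  have hS'n : (derivative S).natDegree = n - 1 := by rw [natDegree_derivative, hSn]
  have hS'0 : derivative S ≠ 0 := by
    intro h0
    have := derivative_eq_zero.1 h0
    omega
  obtain ⟨w, hw⟩ := exists_eq_C_mul_prod hS'n
  set c' := (derivative S).leadingCoeff with hc'
  have hc'0 : c' ≠ 0 := leadingCoeff_ne_zero.2 hS'0
  have hS's : derivative S =
      ∑ i, C ((1 : ℝ) : ℂ) * ∏ k ∈ Finset.univ.erase i, (X - C (s k)) := by
    conv_lhs => rw [hs]
    exact derivative_prod_X_sub_C s
  obtain ⟨hc'n, M₂, hM₂0, hM₂r, hM₂c, hM₂⟩ := exists_substochastic_of_roots s (fun _ => 1)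
    (fun _ => one_pos) w c' hc'0 (by rw [← hw, hS's])
  have hwL : ∀ j, w j ∈ L := by
    intro j
    rw [hM₂]
    simpa only [Complex.real_smul] using
      hL.sum_mem (fun i _ => hM₂0 j i) (hM₂r j) fun i _ => hsL i
  let α : Fin (n - 1) ⊕ Fin p → ℂ := Sum.elim w ζ
  let b : Fin (n - 1) ⊕ Fin p → ℝ := Sum.elim (fun _ => 1) a
  have hb : ∀ x, 0 < b x := by rintro (x | x) <;> simp [b, ha]
  have hαL : ∀ x, α x ∈ L := by rintro (x | x) <;> simp [α, hwL, hζ]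
  -- The Lamé equation divided by the leading coefficient `c'` of S'.
  have hmain : C (-c / c') * ∏ j : Fin (p - 2) ⊕ Fin n, (X - C (Sum.elim v s j)) =
      ∑ x, C (b x : ℂ) * ∏ y ∈ Finset.univ.erase x, (X - C (α y)) := by
    rw [← prod_mul_sum_add_sum_mul_prod w ζ (fun _ => 1) a, ← hQ₁, ← hQ₂,
      ← derivative_prod_X_sub_C w, Fintype.prod_sum_type]
    simp only [Sum.elim_inl, Sum.elim_inr]
    rw [← hv, ← hs]
    apply mul_left_cancel₀ (C_ne_zero.2 hc'0)
    have h2 : derivative (derivative S) = C c' * derivative (∏ i, (X - C (w i))) := by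
      conv_lhs => rw [hw]
      rw [derivative_C_mul]
    rw [← mul_assoc, ← C_mul, mul_div_cancel₀ _ hc'0, C_neg]
    linear_combination -hode + Q₂ * h2 + Q₁ * hw
  obtain ⟨hcb, M₁, hM₁0, hM₁r, hM₁c, hM₁⟩ := exists_substochastic_of_roots α b hb (Sum.elim v s)
    (-c / c') (div_ne_zero (neg_ne_zero.2 hc) hc'0) hmain
  -- Composing the two matrices replaces the zeros of S' by those of S and keeps the row and column
  -- bounds.
  let W : Fin (p - 2) ⊕ Fin n → Fin n → ℝ := fun x i => ∑ k, M₁ x (Sum.inl k) * M₂ k i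
  have hW0 : ∀ x i, 0 ≤ W x i := fun x i =>
    Finset.sum_nonneg fun k _ => mul_nonneg (hM₁0 _ _) (hM₂0 _ _)
  have hWr : ∀ x, ∑ i, W x i + ∑ t, M₁ x (Sum.inr t) = 1 := by
    intro x
    rw [← hM₁r x, Fintype.sum_sum_type, Finset.sum_comm]
    simp only [← Finset.mul_sum, hM₂r, mul_one]
  have hWc : ∀ i, ∑ x, W x i ≤ 1 := by
    intro i
    rw [Finset.sum_comm]
    simp only [← Finset.sum_mul]
    exact (Finset.sum_le_sum fun k _ =>
      mul_le_of_le_one_left (hM₂0 k i) (hM₁c (Sum.inl k))).trans (hM₂c i)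
  have hWbar : ∀ x, Sum.elim v s x = ∑ i, (W x i : ℂ) * s i + ∑ t, (M₁ x (Sum.inr t) : ℂ) * ζ t := by
    intro x
    rw [hM₁ x, Fintype.sum_sum_type]
    simp only [α, W, Sum.elim_inl, Sum.elim_inr, hM₂, Finset.mul_sum, Complex.ofReal_sum,
      Complex.ofReal_mul, Finset.sum_mul]
    rw [Finset.sum_comm]
    simp only [mul_assoc]
  obtain ⟨H, R, hH, hR, hrow, hcol, hmass, hbar⟩ := exists_absorbed_combination
    (fun i j => W (Sum.inl i) j) (fun i t => M₁ (Sum.inl i) (Sum.inr t))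
    (fun i j => W (Sum.inr i) j) (fun i t => M₁ (Sum.inr i) (Sum.inr t))
    (fun _ _ => hW0 _ _) (fun _ _ => hM₁0 _ _) (fun _ _ => hW0 _ _) (fun _ _ => hM₁0 _ _)
    (fun _ => hWr _) (fun _ => hWr _)
    (fun i => by rw [← Fintype.sum_sum_type fun x => W x i]; exact hWc i)
    (fun t => by rw [← Fintype.sum_sum_type fun x => M₁ x (Sum.inr t)]; exact hM₁c _)
    v s ζ (fun i => hWbar (Sum.inl i)) (fun i => hWbar (Sum.inr i))
  refine ⟨ζ, v, s, H, R, hQ₂, hv, fun i => ?_, hsL, hH, hR, hrow, hcol, hmass, hbar, ?_⟩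
  · have := hL.sum_mem (t := Finset.univ) (w := Sum.elim (R i) (H i)) (z := Sum.elim s ζ)
      (by rintro (x | x) - <;> simp [hR, hH]) (by simpa using hrow i)
      (by rintro (x | x) - <;> simp [hsL, hζ])
    rw [hbar i]
    simpa using this
  · intro z e η he hη hz
    have hne : ∀ x ∈ L, z ≠ x := by
      rintro x hx rfl
      have := hz z hx
      simp at this
      linarith
    have e1 := congrArg (eval z) hS's
    rw [eval_sum_C_mul_prod_erase s (fun _ => 1) (fun i => hne _ (hsL i)), ← hs] at e1
    have e2 := congrArg (eval z) hmain
    rw [eval_sum_C_mul_prod_erase α b (fun i => hne _ (hαL i)), Fintype.prod_sum_type,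
      Fintype.prod_sum_type] at e2
    simp only [α, Sum.elim_inl, Sum.elim_inr] at e2
    rw [← hv, ← hs, ← hQ₂, eval_mul, eval_mul, eval_mul, eval_C] at e2
    have e3 := congrArg (eval z) hw
    rw [eval_mul, eval_C] at e3
    have l1 := le_norm_sum_div s (fun _ => 1) (fun _ => one_pos) he fun i => hz _ (hsL i)
    have l2 : (∑ i, b i) * η ≤ ‖∑ i, (b i : ℂ) / (z - Sum.elim w ζ i)‖ :=
      le_norm_sum_div α b hb he fun i => hz _ (hαL i)
    set F := ∑ i, ((1 : ℝ) : ℂ) / (z - s i)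
    set F' := ∑ i, (b i : ℂ) / (z - Sum.elim w ζ i)
    have hn1 : ‖c'‖ = ∑ _i : Fin n, (1 : ℝ) := by
      rw [hc'n]
      simp
    have hn2 : ‖-c / c'‖ = ∑ i, b i := by
      rw [hcb, ← Complex.ofReal_sum, Complex.norm_real, Real.norm_eq_abs,
        abs_of_nonneg (Finset.sum_nonneg fun i _ => (hb i).le)]
    rw [← hn1] at l1
    rw [← hn2] at l2
    have hS0 : S.eval z ≠ 0 := by
      rw [hs]
      exact prod_X_sub_C_eval_ne_zero fun i => hne _ (hsL i)
    -- The constants on the left are the total weights of `F'` and `F` (`hn2`, `hn1`), so they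
    -- cancel against `l2` and `l1` and leave η².
    have hVQ : (-c / c') * c' * V.eval z = Q₂.eval z * (F * F') := by
      apply mul_right_cancel₀ hS0
      linear_combination c' * e2 - Q₂.eval z * F' * e3 + Q₂.eval z * F' * e1
    have hd : 0 < ‖-c / c'‖ * ‖c'‖ := mul_pos
      (norm_pos_iff.2 (div_ne_zero (neg_ne_zero.2 hc) hc'0)) (norm_pos_iff.2 hc'0)
    have hnorm := congrArg norm hVQ
    rw [norm_mul, norm_mul, norm_mul, norm_mul] at hnorm
    refine le_of_mul_le_mul_left ?_ hd
    rw [hnorm]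
    have := mul_le_mul l1 l2 (by positivity) (norm_nonneg _)
    calc _ = ‖Q₂.eval z‖ * (‖c'‖ * η * (‖-c / c'‖ * η)) := by ring
      _ ≤ _ := mul_le_mul_of_nonneg_left this (norm_nonneg _)

/-! ### From martingale couplings to dilations and the Choquet order -/

open ProbabilityTheory

/-- A continuous function on a compact set is integrable over it for every finite measure. -/
theorem integrable_indicator_of_continuousOn {X : Type*} [TopologicalSpace X] [T2Space X]
    [MeasurableSpace X] [BorelSpace X] {L : Set X} (hLc : IsCompact L) {f : X → ℝ}
    (hf : ContinuousOn f L) (μ : Measure X) [IsFiniteMeasure μ] : Integrable (L.indicator f) μ :=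
  (integrable_indicator_iff hLc.measurableSet).2 (hf.integrableOn_compact hLc)

theorem measurable_indicator_of_continuousOn {X : Type*} [TopologicalSpace X] [T2Space X]
    [MeasurableSpace X] [BorelSpace X] {L : Set X} (hLc : IsCompact L) {f : X → ℝ}
    (hf : ContinuousOn f L) : Measurable (L.indicator f) := by
  classical
  rw [← Set.piecewise_eq_indicator]
  exact hf.measurable_piecewise continuousOn_const hLc.measurableSet

/-- The disintegration of a martingale coupling, modified on a null set. -/
theorem exists_kernel_of_martingale {L : Set ℂ} (hLc : IsCompact L)
    (π : Measure (ℂ × ℂ)) [IsProbabilityMeasure π] (hπ : π (L ×ˢ L)ᶜ = 0)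
    (hmart : ∀ g : ℂ → ℝ, Continuous g → HasCompactSupport g →
      ∫ x, g x.1 • (x.2 - x.1) ∂π = 0) :
    ∃ κ : Kernel ℂ ℂ, IsMarkovKernel κ ∧ (∀ x ∈ L, κ x Lᶜ = 0 ∧ ∫ y, y ∂(κ x) = x) ∧
      ∀ f : ℂ → ℝ, ContinuousOn f L →
        ∫ y in L, f y ∂π.snd = ∫ x in L, (∫ y in L, f y ∂(κ x)) ∂π.fst := by
  classical
  have hLm := hLc.measurableSet
  set κ₀ := π.condKernel with hκ₀
  have hdis : π.fst ⊗ₘ κ₀ = π := π.disintegrate _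
  have hsupp : ∀ᵐ x ∂π, x.1 ∈ L ∧ x.2 ∈ L := by
    filter_upwards [mem_ae_iff.2 hπ] with x hx using hx
  have hfst : ∀ᵐ x ∂π.fst, x ∈ L := by
    exact (ae_map_iff (p := fun x => x ∈ L) measurable_fst.aemeasurable hLm).2
      (hsupp.mono fun x hx => hx.1)
  have hsupp' : ∀ᵐ x ∂π.fst, ∀ᵐ y ∂(κ₀ x), y ∈ L := by
    apply Measure.ae_ae_of_ae_compProd (p := fun x => x.2 ∈ L)
    rw [hdis]
    exact hsupp.mono fun x hx => hx.2
  obtain ⟨D, hD⟩ := hLc.isBounded.exists_norm_le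
  have hint : ∀ ρ : Measure ℂ, IsProbabilityMeasure ρ → (∀ᵐ y ∂ρ, y ∈ L) →
      Integrable (fun y : ℂ => y) ρ := fun ρ _ hρ =>
    Integrable.of_bound (by fun_prop) D (hρ.mono fun y hy => hD y hy)
  have hbarm : StronglyMeasurable fun x => ∫ y, y ∂(κ₀ x) :=
    (measurable_id.stronglyMeasurable (α := ℂ)).integral_kernel
  -- The martingale identity says that this function integrates to zero against every smooth
  -- compactly supported `g`.
  have hbar : ∀ᵐ x ∂π.fst, (∫ y, y ∂(κ₀ x)) - x = 0 := by
    refine ae_eq_zero_of_integral_contDiff_smul_eq_zero ?_ ?_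
    · refine Integrable.locallyIntegrable (Integrable.of_bound
        (hbarm.aestronglyMeasurable.sub (by fun_prop)) (D + D) ?_)
      filter_upwards [hfst, hsupp'] with x hx hx'
      refine (norm_sub_le _ _).trans (add_le_add ?_ (hD x hx))
      simpa using norm_integral_le_of_norm_le_const (hx'.mono fun y hy => hD y hy)
    · intro g hg hgc
      obtain ⟨B, hB⟩ := hgc.exists_bound_of_continuous hg.continuous
      have hI : Integrable (fun x : ℂ × ℂ => g x.1 • (x.2 - x.1)) (π.fst ⊗ₘ κ₀) := by
        rw [hdis]
        have := hg.continuous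
        refine Integrable.of_bound (by fun_prop) (B * (D + D)) ?_
        filter_upwards [hsupp] with x hx
        rw [norm_smul]
        exact mul_le_mul (hB _) ((norm_sub_le _ _).trans (add_le_add (hD _ hx.2) (hD _ hx.1)))
          (norm_nonneg _) ((norm_nonneg _).trans (hB 0))
      have h0 := hmart g hg.continuous hgc
      rw [← hdis, Measure.integral_compProd hI] at h0
      rw [← h0]
      refine integral_congr_ae ?_
      filter_upwards [hsupp'] with x hx
      rw [integral_smul, integral_sub (hint _ inferInstance hx) (integrable_const _)]
      simp
  set G : Set ℂ := {x | κ₀ x Lᶜ = 0 ∧ ∫ y, y ∂(κ₀ x) = x} with hG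
  have hGm : MeasurableSet G :=
    (measurableSet_eq_fun (κ₀.measurable_coe hLm.compl) measurable_const).inter
      (measurableSet_eq_fun hbarm.measurable measurable_id)
  have hGae : ∀ᵐ x ∂π.fst, x ∈ G := by
    filter_upwards [hsupp', hbar] with x hx hx'
    exact ⟨mem_ae_iff.1 hx, sub_eq_zero.1 hx'⟩
  -- On the exceptional null set the Dirac mass at x is used; it has barycenter x, so the properties
  -- hold at every point of `L`.
  refine ⟨Kernel.piecewise hGm κ₀ Kernel.id, inferInstance, fun x hx => ?_, fun f hf => ?_⟩
  · rw [Kernel.piecewise_apply]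
    split_ifs with h
    · exact h
    · rw [Kernel.id_apply]
      exact ⟨by simp [hx, hLm.compl], by simp⟩
  · have hfm := measurable_indicator_of_continuousOn hLc hf
    have hfi := integrable_indicator_of_continuousOn hLc hf
    rw [← integral_indicator hLm, Measure.snd, integral_map measurable_snd.aemeasurable
      hfm.aestronglyMeasurable]
    have hfi2 : Integrable (fun x : ℂ × ℂ => L.indicator f x.2) (π.fst ⊗ₘ κ₀) := by
      rw [hdis]
      exact (hfi (π.map Prod.snd)).comp_measurable measurable_snd
    conv_lhs => rw [← hdis]
    rw [Measure.integral_compProd hfi2, Measure.restrict_eq_self_of_ae_mem hfst]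
    refine integral_congr_ae ?_
    filter_upwards [hGae] with x hx
    rw [Kernel.piecewise_apply, if_pos hx, integral_indicator hLm]

theorem restrict_eq_self_of_null {X : Type*} [MeasurableSpace X] {μ : Measure X} {L : Set X}
    (h : μ Lᶜ = 0) : μ.restrict L = μ :=
  Measure.restrict_eq_self_of_ae_mem (mem_ae_iff.2 h)

/-- The Choquet order and a dilation from a martingale coupling. -/
theorem choquetLE_and_exists_dilation_of_martingale {L : Set ℂ} (hLc : IsCompact L)
    (π : Measure (ℂ × ℂ)) [IsProbabilityMeasure π] (hπ : π (L ×ˢ L)ᶜ = 0)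
    (hmart : ∀ g : ℂ → ℝ, Continuous g → HasCompactSupport g →
      ∫ x, g x.1 • (x.2 - x.1) ∂π = 0) :
    ChoquetLE L π.fst π.snd ∧
      ∃ T : L → Measure ℂ, IsDilation L T ∧ IsImageUnder L T π.fst π.snd := by
  obtain ⟨κ, hκ, hκL, hκf⟩ := exists_kernel_of_martingale hLc π hπ hmart
  have hLm := hLc.measurableSet
  have hmeas : ∀ f : ℂ → ℝ, ContinuousOn f L → Measurable fun x => ∫ y in L, f y ∂(κ x) := by
    intro f hf
    simp_rw [← integral_indicator hLm]
    exact ((measurable_indicator_of_continuousOn hLc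
      hf).stronglyMeasurable.integral_kernel (κ := κ)).measurable
  refine ⟨fun f hf hconv => ?_, fun x => κ x, ⟨fun x => ⟨inferInstance, (hκL x x.2).1⟩,
    fun x => ?_, fun f hf => (hmeas f hf).comp measurable_subtype_coe⟩, fun f hf => ?_⟩
  · rw [hκf f hf]
    obtain ⟨D, hD⟩ := (hLc.image_of_continuousOn hf).isBounded.exists_norm_le
    obtain ⟨D', hD'⟩ := hLc.isBounded.exists_norm_le
    refine setIntegral_mono_on (hf.integrableOn_compact hLc) ?_ hLm fun x hx => ?_
    · refine Integrable.of_bound (hmeas f hf).aestronglyMeasurable D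
        ((ae_restrict_iff' hLm).2 (Eventually.of_forall fun x hx => ?_))
      have := norm_setIntegral_le_of_norm_le_const (μ := κ x) (s := L) (f := f) (C := D)
        (measure_lt_top _ _) fun y hy => hD _ ⟨y, hy, rfl⟩
      rw [Measure.real, (prob_compl_eq_zero_iff hLm).1 (hκL x hx).1] at this
      simpa using this
    · have hr := restrict_eq_self_of_null (hκL x hx).1
      have hae : ∀ᵐ y ∂(κ x), y ∈ L := mem_ae_iff.2 (hκL x hx).1
      have hj := hconv.map_integral_le hf hLc.isClosed (μ := κ x) (f := fun y => y) hae
        (Integrable.of_bound (by fun_prop) D' (hae.mono fun y hy => hD' y hy))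
        (by
          have := hf.integrableOn_compact (μ := κ x) hLc
          rwa [IntegrableOn, hr] at this)
      rw [(hκL x hx).2] at hj
      rw [hr]
      exact hj
  · rw [barycenter, average_eq_integral]
    exact (hκL x x.2).2
  · rw [hκf f hf, ← integral_subtype_comap hLm]

/-! ### Weak convergence and root-counting measures -/

/-- Weak convergence of measures on a compact set, tested against a function that is continuous on
this set. -/
theorem tendsto_integral_of_continuousOn {X ι : Type*} [TopologicalSpace X] [T4Space X]
    [MeasurableSpace X] [BorelSpace X] {L : Set X} (hLc : IsCompact L) {l : Filter ι}
    {μs : ι → FiniteMeasure X} {μ : FiniteMeasure X} (h : Tendsto μs l (𝓝 μ))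
    (hμs : ∀ᶠ i in l, (μs i : Measure X) Lᶜ = 0) (hμ : (μ : Measure X) Lᶜ = 0) {f : X → ℝ}
    (hf : ContinuousOn f L) :
    Tendsto (fun i => ∫ x, f x ∂(μs i : Measure X)) l (𝓝 (∫ x, f x ∂(μ : Measure X))) := by
  have : CompactSpace L := isCompact_iff_compactSpace.1 hLc
  -- Tietze extension: off `L` the values of `f` do not matter.
  obtain ⟨g, -, hg⟩ := BoundedContinuousFunction.exists_extension_norm_eq_of_isClosedEmbedding
    (BoundedContinuousFunction.mkOfCompact ⟨L.domRestrict f, hf.domRestrict⟩)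
    hLc.isClosed.isClosedEmbedding_subtypeVal
  have hgf : ∀ x ∈ L, g x = f x := fun x hx => by
    exact congrFun hg ⟨x, hx⟩
  have heq : ∀ ν : FiniteMeasure X, (ν : Measure X) Lᶜ = 0 →
      ∫ x, g x ∂(ν : Measure X) = ∫ x, f x ∂(ν : Measure X) := fun ν hν =>
    integral_congr_ae ((show ∀ᵐ x ∂(ν : Measure X), x ∈ L from mem_ae_iff.2 hν).mono hgf)
  rw [← heq μ hμ]
  exact (FiniteMeasure.tendsto_iff_forall_integral_tendsto.1 h g).congr' (hμs.mono fun i hi =>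
    heq _ hi)

/-- The discrete measure with masses `w i` at the points `x i`. -/
noncomputable def discreteMeasure {ι X : Type*} [Fintype ι] [MeasurableSpace X] (w : ι → ℝ≥0)
    (x : ι → X) : FiniteMeasure X :=
  ∑ i, w i • (diracProba (x i)).toFiniteMeasure

theorem toMeasure_discreteMeasure {ι X : Type*} [Fintype ι] [MeasurableSpace X] (w : ι → ℝ≥0)
    (x : ι → X) :
    (discreteMeasure w x : Measure X) = ∑ i, w i • Measure.dirac (x i) := by
  rw [discreteMeasure, FiniteMeasure.toMeasure_sum]
  rfl

theorem integral_discreteMeasure {ι X E : Type*} [Fintype ι] [MeasurableSpace X]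
    [MeasurableSingletonClass X] [NormedAddCommGroup E] [NormedSpace ℝ E] [CompleteSpace E]
    (w : ι → ℝ≥0) (x : ι → X) (f : X → E) :
    ∫ y, f y ∂(discreteMeasure w x : Measure X) = ∑ i, w i • f (x i) := by
  rw [toMeasure_discreteMeasure, integral_finsetSum_measure]
  · simp
  · intro i _
    exact (integrable_dirac (by simp)).smul_measure_nnreal

theorem discreteMeasure_mem {ι X : Type*} [Fintype ι] [MeasurableSpace X] {w : ι → ℝ≥0}
    {x : ι → X} {L : Set X} (hL : MeasurableSet L) (hw : ∑ i, w i = 1) (hx : ∀ i, x i ∈ L) :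
    discreteMeasure w x ∈ {μ : FiniteMeasure X | μ.mass = 1 ∧ (μ : Measure X) Lᶜ = 0} := by
  constructor
  · rw [← hw, ← ENNReal.coe_inj, FiniteMeasure.ennreal_mass, toMeasure_discreteMeasure,
      Measure.finsetSum_apply, ENNReal.ofNNReal_finsetSum]
    refine Finset.sum_congr rfl fun i _ => ?_
    rw [Measure.smul_apply, measure_univ, ENNReal.smul_def, smul_eq_mul, mul_one]
  · rw [toMeasure_discreteMeasure]
    simp [Measure.finsetSum_apply, Measure.dirac_apply' _ hL.compl, hx]

theorem isCompact_setOf_mass_eq_one {X : Type*} [TopologicalSpace X] [T2Space X] [NormalSpace X]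
    [MeasurableSpace X] [BorelSpace X] {L : Set X} (hLc : IsCompact L) :
    IsCompact {μ : FiniteMeasure X | μ.mass = 1 ∧ (μ : Measure X) Lᶜ = 0} := by
  -- Prokhorov's theorem; the constant family `L` with bound 0 expresses tightness.
  convert isCompact_setOfPred_finiteMeasure_mass_eq_compl_isCompact_le (u := fun _ => 0)
    (K := fun _ => L) 1 tendsto_const_nhds (fun _ => hLc) (Or.inl inferInstance) using 3 with μ
  simp [FiniteMeasure.null_iff_toMeasure_null]

theorem rootCountingMeasure_prod {d : ℕ} (f : Fin d → ℂ) :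
    rootCountingMeasure (∏ i, (X - C (f i))) = discreteMeasure (fun _ => (d : ℝ≥0)⁻¹) f := by
  rw [rootCountingMeasure, discreteMeasure, roots_prod_univ_X_sub_C, Multiset.map_map,
    ← Finset.smul_sum]
  simp [Finset.sum]

theorem integral_rootCountingMeasure_prod {d : ℕ} (f : Fin d → ℂ) (g : ℂ → ℝ) :
    ∫ z, g z ∂(rootCountingMeasure (∏ i, (X - C (f i))) : Measure ℂ) =
      (d : ℝ)⁻¹ * ∑ i, g (f i) := by
  rw [rootCountingMeasure_prod, integral_discreteMeasure, Finset.mul_sum]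
  simp [NNReal.smul_def]

theorem rootCountingMeasure_prod_mem {d : ℕ} (hd : d ≠ 0) {f : Fin d → ℂ} {L : Set ℂ}
    (hL : MeasurableSet L) (hf : ∀ i, f i ∈ L) :
    rootCountingMeasure (∏ i, (X - C (f i))) ∈
      {μ : FiniteMeasure ℂ | μ.mass = 1 ∧ (μ : Measure ℂ) Lᶜ = 0} := by
  rw [rootCountingMeasure_prod]
  refine discreteMeasure_mem hL ?_ hf
  simp [hd]

/-! ### Couplings and potentials for fixed p -/

/-- The root-counting measures of a Van Vleck polynomial and of `Q₂` admit an approximate martingale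
coupling. -/
theorem exists_approximate_martingale_coupling {p n : ℕ} (hp : 3 ≤ p) (hn : 1 ≤ n)
    {Q₂ Q₁ V S : ℂ[X]} {c : ℂ}
    (hQ : IsAdmissiblePair p Q₂ Q₁) (hS : S.Monic) (hSn : S.natDegree = n) (hV : V.Monic)
    (hVn : V.natDegree = p - 2) (hc : c ≠ 0) (hSV : IsSpectralPair p n Q₂ Q₁ (C c * V) S)
    {L : Set ℂ} (hL : Convex ℝ L) (hLc : IsClosed L) (hζL : ∀ z, Q₂.IsRoot z → z ∈ L) :
    ∃ π : FiniteMeasure (ℂ × ℂ), (π.mass = 1 ∧ (π : Measure (ℂ × ℂ)) (L ×ˢ L)ᶜ = 0) ∧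
      (∀ f : ℂ → ℝ, ∫ x, f x.1 ∂(π : Measure (ℂ × ℂ)) =
        ∫ x, f x ∂(rootCountingMeasure V : Measure ℂ)) ∧
      (∀ (f : ℂ → ℝ) (B : ℝ), (∀ x ∈ L, |f x| ≤ B) →
        |∫ x, f x.2 ∂(π : Measure (ℂ × ℂ)) - ∫ x, f x ∂(rootCountingMeasure Q₂ : Measure ℂ)| ≤
          6 * B / (p - 2 : ℕ)) ∧
      ∀ g : ℂ → ℝ, ∫ x, g x.1 • (x.2 - x.1) ∂(π : Measure (ℂ × ℂ)) = 0 := by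
  obtain ⟨ζ, v, s, H, R, hQ₂, hv, hvL, hsL, hH, hR, hrow, hcol, hmass, hbar, -⟩ :=
    exists_coupling (by omega) hn hQ hS hSn hV hVn hc hSV hL hLc hζL
  have hζL' : ∀ i, ζ i ∈ L := fun i => hζL _ <| by
    rw [hQ₂, IsRoot, eval_prod]
    exact Finset.prod_eq_zero (Finset.mem_univ i) (by simp)
  set d : ℝ := ((p - 2 : ℕ) : ℝ) with hd
  have hdp : (p : ℝ) = d + 2 := by rw [hd, Nat.cast_sub (by omega)]; simp
  have hd0 : 0 < d := by rw [hd]; exact_mod_cast (by omega : 0 < p - 2)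
  let M : Fin (p - 2) → Fin n ⊕ Fin p → ℝ := fun i => Sum.elim (R i) (H i)
  let y : Fin n ⊕ Fin p → ℂ := Sum.elim s ζ
  have hM : ∀ i x, 0 ≤ M i x / d := by
    rintro i (x | x)
    · exact div_nonneg (hR i x) hd0.le
    · exact div_nonneg (hH i x) hd0.le
  have hyL : ∀ x, y x ∈ L := by rintro (x | x) <;> simp [y, hsL, hζL']
  have hMrow : ∀ i, ∑ x, M i x = 1 := fun i => by simpa [M] using hrow i
  have hMbar : ∀ i, ∑ x, (M i x : ℂ) * y x = v i := fun i => by simpa [M, y] using (hbar i).symm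
  let w : Fin (p - 2) × (Fin n ⊕ Fin p) → ℝ≥0 := fun x => (M x.1 x.2 / d).toNNReal
  let pt : Fin (p - 2) × (Fin n ⊕ Fin p) → ℂ × ℂ := fun x => (v x.1, y x.2)
  have hw : ∀ x, (w x : ℝ) = M x.1 x.2 / d := fun x => Real.coe_toNNReal _ (hM _ _)
  refine ⟨discreteMeasure w pt, discreteMeasure_mem (hLc.prod hLc).measurableSet ?_
    fun x => ⟨hvL _, hyL _⟩, fun f => ?_, fun f B hB => ?_, fun g => ?_⟩
  · rw [← NNReal.coe_inj, NNReal.coe_sum, Fintype.sum_prod_type]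
    simp only [hw, ← Finset.sum_div, hMrow]
    simp [← hd, hd0.ne']
  · rw [integral_discreteMeasure, hv, integral_rootCountingMeasure_prod, Fintype.sum_prod_type,
      Finset.mul_sum]
    refine Finset.sum_congr rfl fun i _ => ?_
    simp only [NNReal.smul_def, hw, pt, smul_eq_mul, ← Finset.sum_mul, ← Finset.sum_div, hMrow,
      ← hd, one_div]
  · have hB0 : 0 ≤ B := (abs_nonneg _).trans (hB _ (hζL' ⟨0, by omega⟩))
    set h : Fin p → ℝ := fun t => ∑ i, H i t with hh
    set r : Fin n → ℝ := fun j => ∑ i, R i j with hr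
    have hr0 : ∀ j, 0 ≤ r j := fun j => Finset.sum_nonneg fun i _ => hR i j
    have hr1 : ∑ j, r j ≤ 1 := by rwa [hr, Finset.sum_comm]
    have htot : ∑ j, r j + ∑ t, h t = d := by
      rw [hr, hh, Finset.sum_comm, Finset.sum_comm (f := fun t i => H i t),
        ← Finset.sum_add_distrib]
      simp [hrow, ← hd]
    have heq : ∫ x, f x.2 ∂(discreteMeasure w pt : Measure (ℂ × ℂ)) -
        ∫ x, f x ∂(rootCountingMeasure Q₂ : Measure ℂ) =
        ∑ j, r j / d * f (s j) + ∑ t, (h t / d - (p : ℝ)⁻¹) * f (ζ t) := by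
      rw [integral_discreteMeasure, hQ₂, integral_rootCountingMeasure_prod,
        Fintype.sum_prod_type, Finset.sum_comm, Fintype.sum_sum_type, Finset.mul_sum, add_sub_assoc,
        ← Finset.sum_sub_distrib]
      simp only [NNReal.smul_def, hw, pt, smul_eq_mul, ← Finset.sum_mul, ← Finset.sum_div, M, y,
        Sum.elim_inl, Sum.elim_inr, ← sub_mul, hr, hh]
    have hpd : (p : ℝ)⁻¹ ≤ d⁻¹ := inv_anti₀ hd0 (by linarith)
    have hb1 : |∑ j, r j / d * f (s j)| ≤ ∑ j, r j / d * B := by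
      refine (Finset.abs_sum_le_sum_abs _ _).trans (Finset.sum_le_sum fun j _ => ?_)
      rw [abs_mul, abs_of_nonneg (div_nonneg (hr0 j) hd0.le)]
      exact mul_le_mul_of_nonneg_left (hB _ (hsL j)) (div_nonneg (hr0 j) hd0.le)
    have hb2 : |∑ t, (h t / d - (p : ℝ)⁻¹) * f (ζ t)| ≤
        ∑ t, ((1 - h t) / d + (d⁻¹ - (p : ℝ)⁻¹)) * B := by
      refine (Finset.abs_sum_le_sum_abs _ _).trans (Finset.sum_le_sum fun t _ => ?_)
      rw [abs_mul]
      refine mul_le_mul ?_ (hB _ (hζL' t)) (abs_nonneg _) ?_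
      · have e1 : h t / d - (p : ℝ)⁻¹ = -((1 - h t) / d) + (d⁻¹ - (p : ℝ)⁻¹) := by ring
        rw [e1]
        refine (abs_add_le _ _).trans_eq ?_
        rw [abs_neg, abs_of_nonneg (div_nonneg (sub_nonneg.2 (hcol t)) hd0.le),
          abs_of_nonneg (sub_nonneg.2 hpd)]
      · exact add_nonneg (div_nonneg (sub_nonneg.2 (hcol t)) hd0.le) (sub_nonneg.2 hpd)
    rw [heq]
    refine (abs_add_le _ _).trans ((add_le_add hb1 hb2).trans ?_)
    rw [← Finset.sum_mul, ← Finset.sum_mul, ← Finset.sum_div, Finset.sum_add_distrib,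
      ← Finset.sum_div, Finset.sum_sub_distrib]
    simp only [Finset.sum_const, Finset.card_univ, Fintype.card_fin, nsmul_eq_mul, mul_one]
    rw [mul_sub, mul_inv_cancel₀ (by linarith), ← add_mul, mul_comm (6 : ℝ), mul_div_assoc,
      mul_comm]
    -- With r = ∑ r_j ≤ 1 the total variation error times d = p - 2 is r (mass on `s`), plus 2 + r
    -- (column deficits), plus 2 (from 1/d against 1/p): 2r + 4 ≤ 6.
    refine mul_le_mul_of_nonneg_left ?_ hB0
    rw [le_div_iff₀ hd0, hdp]
    have e2 : ((∑ j, r j) / d + ((d + 2 - ∑ t, h t) / d + ((d + 2) * d⁻¹ - 1))) * d =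
        ∑ j, r j + (d + 2 - ∑ t, h t) + 2 := by
      field_simp
      ring
    rw [e2]
    linarith
  · rw [integral_discreteMeasure, Fintype.sum_prod_type]
    refine Finset.sum_eq_zero fun i _ => ?_
    have e1 : ∀ x, w (i, x) • (g (v i) • (y x - v i)) =
        ((g (v i) / d : ℝ) : ℂ) * ((M i x : ℂ) * y x - (M i x : ℂ) * v i) := by
      intro x
      rw [NNReal.smul_def, hw, Complex.real_smul, Complex.real_smul]
      push_cast
      ring
    simp only [pt, e1]
    rw [← Finset.mul_sum, Finset.sum_sub_distrib, hMbar, ← Finset.sum_mul, ← Complex.ofReal_sum,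
      hMrow]
    simp

/-- Comparison of the logarithmic potentials of the root-counting measures of a Van Vleck polynomial
and of `Q₂`. -/
theorem logPotential_rootCountingMeasure_le {p n : ℕ} (hp : 3 ≤ p) (hn : 1 ≤ n)
    {Q₂ Q₁ V S : ℂ[X]} {c : ℂ}
    (hQ : IsAdmissiblePair p Q₂ Q₁) (hS : S.Monic) (hSn : S.natDegree = n) (hV : V.Monic)
    (hVn : V.natDegree = p - 2) (hc : c ≠ 0) (hSV : IsSpectralPair p n Q₂ Q₁ (C c * V) S)
    {L : Set ℂ} (hL : Convex ℝ L) (hLc : IsClosed L) (hζL : ∀ z, Q₂.IsRoot z → z ∈ L)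
    {z e : ℂ} {η : ℝ} (hz : z ∉ L) (he : ‖e‖ ≤ 1) (hη : 0 < η)
    (hzL : ∀ x ∈ L, η ≤ (e / (z - x)).re) :
    2 * Real.log η / (p - 2 : ℕ) + (p : ℝ) / (p - 2 : ℕ) *
        ∫ w, Real.log ‖z - w‖ ∂(rootCountingMeasure Q₂ : Measure ℂ) ≤
      ∫ w, Real.log ‖z - w‖ ∂(rootCountingMeasure V : Measure ℂ) := by
  obtain ⟨ζ, v, s, H, R, hQ₂, hv, hvL, -, -, -, -, -, -, -, hlow⟩ :=
    exists_coupling (by omega) hn hQ hS hSn hV hVn hc hSV hL hLc hζL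
  have hζL' : ∀ i, ζ i ∈ L := fun i => hζL _ <| by
    rw [hQ₂, IsRoot, eval_prod]
    exact Finset.prod_eq_zero (Finset.mem_univ i) (by simp)
  have hne : ∀ x ∈ L, z - x ≠ 0 := fun x hx h => hz (by rwa [sub_eq_zero.1 h])
  have hlog : ∀ {d : ℕ} (f : Fin d → ℂ), (∀ i, f i ∈ L) →
      ∑ i, Real.log ‖z - f i‖ = Real.log ‖(∏ i, (X - C (f i))).eval z‖ := by
    intro d f hf
    rw [eval_prod, norm_prod, Real.log_prod fun i _ => by simpa using hne _ (hf i)]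
    simp
  have hQ0 : 0 < ‖Q₂.eval z‖ := by
    rw [hQ₂]
    exact norm_pos_iff.2 (prod_X_sub_C_eval_ne_zero fun i => sub_ne_zero.1 (hne _ (hζL' i)))
  have hmain := Real.log_le_log (by positivity) (hlow z e η he hη hzL)
  rw [Real.log_mul (by positivity) hQ0.ne', Real.log_pow] at hmain
  have hp0 : (p : ℝ) ≠ 0 := by exact_mod_cast (by omega : p ≠ 0)
  have hd0 : (0 : ℝ) < (p - 2 : ℕ) := by exact_mod_cast (by omega : 0 < p - 2)
  conv_lhs => rw [hQ₂]
  conv_rhs => rw [hv]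
  rw [integral_rootCountingMeasure_prod ζ fun w => Real.log ‖z - w‖,
    integral_rootCountingMeasure_prod v fun w => Real.log ‖z - w‖, hlog ζ hζL', hlog v hvL, ← hQ₂,
    ← hv, div_mul_eq_mul_div, mul_inv_cancel_left₀ hp0, ← add_div, inv_mul_eq_div]
  exact div_le_div_of_nonneg_right (by exact_mod_cast hmain) hd0.le

/-! ### Compactness and passage to the limit -/

/-- A sequence of probability measures on a compact set has a convergent subsequence. -/
theorem exists_tendsto_subseq {L : Set ℂ} (hLc : IsCompact L) (μ : ℕ → FiniteMeasure ℂ)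
    (hμ : ∀ k, (μ k).mass = 1 ∧ (μ k : Measure ℂ) Lᶜ = 0) :
    ∃ (φ : ℕ → ℕ) (ν : FiniteMeasure ℂ), StrictMono φ ∧ Tendsto (μ ∘ φ) atTop (𝓝 ν) := by
  let P : ℕ → ProbabilityMeasure ℂ := fun k => ⟨μ k, ⟨by
    rw [← FiniteMeasure.ennreal_mass, (hμ k).1, ENNReal.coe_one]⟩⟩
  have hc := isCompact_setOfPred_probabilityMeasure_mass_eq_compl_isCompact_le (u := fun _ => 0)
    (K := fun _ => L) tendsto_const_nhds (fun _ => hLc) (Or.inl inferInstance)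
  obtain ⟨ν, -, φ, hφ, hlim⟩ := hc.tendsto_subseq (x := P) fun k => by
    intro _
    rw [nonpos_iff_eq_zero, ProbabilityMeasure.null_iff_toMeasure_null]
    exact (hμ k).2
  exact ⟨φ, ν.toFiniteMeasure, hφ,
    (ProbabilityMeasure.toFiniteMeasure_continuous.tendsto ν).comp hlim⟩

/-- Translates convergence of a subsequence into convergence along its set of indices, the form used
in `WeakStarLim`. -/
theorem map_atTop_of_strictMono {φ : ℕ → ℕ} (hφ : StrictMono φ) :
    map φ atTop = atTop ⊓ 𝓟 (Set.range φ) := by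
  rw [← Filter.map_comap, comap_embedding_atTop (fun _ _ => hφ.le_iff_le) fun c =>
    ⟨c, hφ.id_le c⟩]

theorem neBot_atTop_inf_principal {Γ : Set ℕ} (hΓ : Γ.Infinite) : (atTop ⊓ 𝓟 Γ).NeBot := by
  rw [← frequently_mem_iff_neBot]
  exact Nat.frequently_atTop_iff_infinite.2 hΓ

theorem mem_probOn_of_mass_eq_one {μ : FiniteMeasure ℂ} {L : Set ℂ}
    (h : μ.mass = 1 ∧ (μ : Measure ℂ) Lᶜ = 0) : (μ : Measure ℂ) ∈ probOn L :=
  ⟨⟨by rw [← FiniteMeasure.ennreal_mass, h.1, ENNReal.coe_one]⟩, h.2⟩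

/-- By Carathéodory's theorem in the plane three points suffice, so the hull is a continuous image
of a compact set; unused slots get weight 0 and the point `x₀`. -/
theorem isCompact_convexHull {K : Set ℂ} (hK : IsCompact K) : IsCompact (convexHull ℝ K) := by
  rcases K.eq_empty_or_nonempty with rfl | ⟨x₀, hx₀⟩
  · simp
  have himage : convexHull ℝ K = (fun x : (Fin 3 → ℝ) × (Fin 3 → ℂ) => ∑ i, x.1 i • x.2 i) ''
      (stdSimplex ℝ (Fin 3) ×ˢ Set.univ.pi fun _ => K) := by
    refine Set.Subset.antisymm (fun x hx => ?_) ?_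
    · obtain ⟨ι, _, z, w, hz, hind, hw, hw1, hwz⟩ := eq_pos_convex_span_of_mem_convexHull hx
      have hcard : Fintype.card ι ≤ Fintype.card (Fin 3) := by
        have := hind.card_le_finrank_succ.trans
          (Nat.add_le_add_right (Submodule.finrank_le _) 1)
        rwa [Complex.finrank_real_complex] at this
      obtain ⟨j⟩ := Function.Embedding.nonempty_of_card_le hcard
      have hext : ∀ i, i ∉ Set.range j → Function.extend j w 0 i = 0 := fun i hi =>
        Function.extend_apply' _ _ _ fun ⟨a, ha⟩ => hi ⟨a, ha⟩
      refine ⟨(Function.extend j w 0, Function.extend j z fun _ => x₀), ⟨⟨fun i => ?_, ?_⟩,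
        fun i _ => ?_⟩, ?_⟩
      · by_cases hi : i ∈ Set.range j
        · obtain ⟨a, rfl⟩ := hi
          simp only [j.injective.extend_apply]
          exact (hw a).le
        · exact (hext i hi).ge
      · rw [← hw1]
        exact (Fintype.sum_of_injective j j.injective _ _ hext fun a =>
          (j.injective.extend_apply _ _ _).symm).symm
      · by_cases hi : i ∈ Set.range j
        · obtain ⟨a, rfl⟩ := hi
          simp only [j.injective.extend_apply]
          exact hz ⟨a, rfl⟩
        · simp only [Function.extend_apply' _ _ _ fun ⟨a, ha⟩ => hi ⟨a, ha⟩]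
          exact hx₀
      · rw [← hwz]
        refine (Fintype.sum_of_injective j j.injective _ _ (fun i hi => ?_) fun a => ?_).symm
        · simp only [hext i hi, zero_smul]
        · simp only [j.injective.extend_apply]
    · rintro _ ⟨⟨w, z⟩, ⟨hw, hz⟩, rfl⟩
      exact (convex_convexHull ℝ K).sum_mem (fun i _ => hw.1 i) hw.2 fun i _ =>
        subset_convexHull ℝ K (hz i trivial)
  rw [himage]
  exact ((isCompact_stdSimplex ℝ (Fin 3)).prod (isCompact_univ_pi fun _ => hK)).image (by fun_prop)

/-- A limit point of approximate martingale couplings is a martingale coupling of the limits of the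
marginals. -/
theorem exists_martingale_coupling_of_tendsto {L : Set ℂ} (hLc : IsCompact L) {l : Filter ℕ}
    (hl : l.NeBot) (hev : ∀ᶠ p in l, 3 ≤ p) (hl' : l ≤ atTop) {μs νs : ℕ → FiniteMeasure ℂ}
    {μ ν : FiniteMeasure ℂ} (hμ : Tendsto μs l (𝓝 μ)) (hν : Tendsto νs l (𝓝 ν))
    (h : ∀ p, 3 ≤ p → ∃ π : FiniteMeasure (ℂ × ℂ),
      (π.mass = 1 ∧ (π : Measure (ℂ × ℂ)) (L ×ˢ L)ᶜ = 0) ∧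
      (∀ f : ℂ → ℝ, ∫ x, f x.1 ∂(π : Measure (ℂ × ℂ)) = ∫ x, f x ∂(μs p : Measure ℂ)) ∧
      (∀ (f : ℂ → ℝ) (B : ℝ), (∀ x ∈ L, |f x| ≤ B) → |∫ x, f x.2 ∂(π : Measure (ℂ × ℂ)) -
        ∫ x, f x ∂(νs p : Measure ℂ)| ≤ 6 * B / (p - 2 : ℕ)) ∧
      ∀ g : ℂ → ℝ, ∫ x, g x.1 • (x.2 - x.1) ∂(π : Measure (ℂ × ℂ)) = 0) :
    ∃ π : FiniteMeasure (ℂ × ℂ), (π.mass = 1 ∧ (π : Measure (ℂ × ℂ)) (L ×ˢ L)ᶜ = 0) ∧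
      (π : Measure (ℂ × ℂ)).fst = μ ∧ (π : Measure (ℂ × ℂ)).snd = ν ∧
      ∀ g : ℂ → ℝ, Continuous g →
        ∫ x, g x.1 • (x.2 - x.1) ∂(π : Measure (ℂ × ℂ)) = 0 := by
  choose! πs hπs hfst hsnd hmart using h
  have hLL : IsCompact (L ×ˢ L) := hLc.prod hLc
  -- Along an ultrafilter the couplings converge by compactness alone, and the given limits of the
  -- marginals persist.
  let 𝒰 := Ultrafilter.of l
  have h𝒰 : (𝒰 : Filter ℕ) ≤ l := Ultrafilter.of_le l
  have hev𝒰 : ∀ᶠ p in (𝒰 : Filter ℕ), 3 ≤ p := hev.filter_mono h𝒰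
  obtain ⟨π, hπ, hlim⟩ := (isCompact_setOf_mass_eq_one hLL).ultrafilter_le_nhds (𝒰.map πs)
    (le_principal_iff.2 (hev𝒰.mono hπs))
  replace hlim : Tendsto πs 𝒰 (𝓝 π) := hlim
  have htest : ∀ f : ℂ × ℂ → ℝ, Continuous f → Tendsto
      (fun p => ∫ x, f x ∂(πs p : Measure (ℂ × ℂ))) 𝒰 (𝓝 (∫ x, f x ∂(π : Measure (ℂ × ℂ)))) :=
    fun f hf => tendsto_integral_of_continuousOn hLL hlim (hev𝒰.mono fun p hp => (hπs p hp).2)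
      hπ.2 hf.continuousOn
  refine ⟨π, hπ, ?_, ?_, fun g hg => ?_⟩
  · refine ext_of_forall_integral_eq_of_IsFiniteMeasure fun f => ?_
    rw [Measure.fst, integral_map measurable_fst.aemeasurable (by fun_prop)]
    refine tendsto_nhds_unique ((htest (fun x => f x.1) (by fun_prop)).congr'
      (hev𝒰.mono fun p hp => hfst p hp f)) ?_
    exact (FiniteMeasure.tendsto_iff_forall_integral_tendsto.1 hμ f).mono_left h𝒰
  · refine ext_of_forall_integral_eq_of_IsFiniteMeasure fun f => ?_
    rw [Measure.snd, integral_map measurable_snd.aemeasurable (by fun_prop)]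
    refine tendsto_nhds_unique (htest (fun x => f x.2) (by fun_prop)) ?_
    have h1 := (FiniteMeasure.tendsto_iff_forall_integral_tendsto.1 hν f).mono_left h𝒰
    have hsub : Tendsto (fun p : ℕ => ((p - 2 : ℕ) : ℝ)) 𝒰 atTop :=
      (tendsto_natCast_atTop_atTop.comp (tendsto_sub_atTop_nat 2)).mono_left (h𝒰.trans hl')
    have h2 : Tendsto (fun p => ∫ x, f x.2 ∂(πs p : Measure (ℂ × ℂ)) -
        ∫ x, f x ∂(νs p : Measure ℂ)) 𝒰 (𝓝 0) :=
      squeeze_zero_norm' (hev𝒰.mono fun p hp => hsnd p hp f ‖f‖ fun x _ => f.norm_coe_le_norm x)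
        (hsub.const_div_atTop _)
    simpa using h2.add h1
  · have hint : ∀ ρ : FiniteMeasure (ℂ × ℂ), (ρ : Measure (ℂ × ℂ)) (L ×ˢ L)ᶜ = 0 →
        Integrable (fun x : ℂ × ℂ => g x.1 • (x.2 - x.1)) (ρ : Measure (ℂ × ℂ)) := by
      intro ρ hρ
      have hc : ContinuousOn (fun x : ℂ × ℂ => g x.1 • (x.2 - x.1)) (L ×ˢ L) := by fun_prop
      have := hc.integrableOn_compact (μ := (ρ : Measure (ℂ × ℂ))) hLL
      rwa [IntegrableOn, restrict_eq_self_of_null hρ] at this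
    -- Weak convergence is tested on real functions, so the complex identity is checked through real
    -- functionals.
    have hzero : ∀ φ : ℂ →L[ℝ] ℝ, φ (∫ x, g x.1 • (x.2 - x.1) ∂(π : Measure (ℂ × ℂ))) = 0 := by
      intro φ
      rw [← φ.integral_comp_comm (hint π hπ.2)]
      refine tendsto_nhds_unique (htest _ (by fun_prop)) (tendsto_const_nhds.congr'
        (hev𝒰.mono fun p hp => ?_))
      show 0 = ∫ x, φ (g x.1 • (x.2 - x.1)) ∂(πs p : Measure (ℂ × ℂ))
      rw [φ.integral_comp_comm (hint _ (hπs p hp).2), hmart p hp g, map_zero]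
    exact Complex.ext (hzero Complex.reCLM) (hzero Complex.imCLM)

end Lame

/-! ### The limit theorem -/

theorem corollary3p3
    (Q₂ Q₁ : ℕ → ℂ[X])
    (hQ : ∀ p, 2 ≤ p → Lame.IsAdmissiblePair p (Q₂ p) (Q₁ p))
    (hsolv : ∀ p, 2 ≤ p → Lame.IsSolvable p (Q₂ p) (Q₁ p))
    (K : Set ℂ) (hK : IsCompact K)
    (hKQ : ∀ p, 2 ≤ p → ∀ z : ℂ, (Q₂ p).IsRoot z → z ∈ K)
    (S V : ℕ → ℕ → ℂ[X])
    (hS : ∀ p n, 2 ≤ p → 1 ≤ n → (S p n).Monic ∧ (S p n).natDegree = n)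
    (hV : ∀ p n, 2 ≤ p → 1 ≤ n → (V p n).Monic ∧ (V p n).natDegree = p - 2)
    -- up to normalization, `V p n` is a Van Vleck polynomial that corresponds to `S p n`
    (hSV : ∀ p n, 2 ≤ p → 1 ≤ n → ∃ c : ℂ, c ≠ 0 ∧
      Lame.IsSpectralPair p n (Q₂ p) (Q₁ p) (C c * V p n) (S p n))
    (N : ℕ → ℕ) (hN : ∀ p, 2 ≤ p → 1 ≤ N p) :
    -- a set of indices along which both limits exist can be chosen
    (∃ (Γ : Set ℕ) (μV μQ : FiniteMeasure ℂ), Γ.Infinite ∧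
      Lame.WeakStarLim Γ (fun p => Lame.rootCountingMeasure (V p (N p))) μV ∧
      Lame.WeakStarLim Γ (fun p => Lame.rootCountingMeasure (Q₂ p)) μQ) ∧
    -- and for every such set of indices
    ∀ (Γ : Set ℕ) (μV μQ : FiniteMeasure ℂ), Γ.Infinite →
      Lame.WeakStarLim Γ (fun p => Lame.rootCountingMeasure (V p (N p))) μV →
      Lame.WeakStarLim Γ (fun p => Lame.rootCountingMeasure (Q₂ p)) μQ →
      (μV : Measure ℂ) ∈ Lame.probOn (convexHull ℝ K) ∧
      (μQ : Measure ℂ) ∈ Lame.probOn K ∧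
      Lame.ChoquetLE (convexHull ℝ K) μV μQ ∧
      (∃ T : convexHull ℝ K → Measure ℂ, Lame.IsDilation (convexHull ℝ K) T ∧
        Lame.IsImageUnder (convexHull ℝ K) T μV μQ) ∧
      (∀ m : ℕ, Lame.moment μV m ≤ Lame.moment μQ m) ∧
      (∀ z : ℂ, z ∉ convexHull ℝ K →
        Lame.logPotential μQ z ≤ Lame.logPotential μV z) := by
  have hLc : IsCompact (convexHull ℝ K) := Lame.isCompact_convexHull hK
  have hL : Convex ℝ (convexHull ℝ K) := convex_convexHull ℝ K
  have hKL : K ⊆ convexHull ℝ K := subset_convexHull ℝ K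
  set L := convexHull ℝ K with hLdef
  have hζL : ∀ p, 3 ≤ p → ∀ z, (Q₂ p).IsRoot z → z ∈ L := fun p hp z hz =>
    hKL (hKQ p (by omega) z hz)
  have hVmem : ∀ p, 3 ≤ p → (Lame.rootCountingMeasure (V p (N p))).mass = 1 ∧
      (Lame.rootCountingMeasure (V p (N p)) : Measure ℂ) Lᶜ = 0 := by
    intro p hp
    obtain ⟨c, hc, hsp⟩ := hSV p (N p) (by omega) (hN p (by omega))
    have hSp := hS p (N p) (by omega) (hN p (by omega))
    have hVp := hV p (N p) (by omega) (hN p (by omega))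
    obtain ⟨ζ, v, s, H, R, -, hv, hvL, -⟩ := Lame.exists_coupling (by omega) (hN p (by omega))
      (hQ p (by omega)) hSp.1 hSp.2 hVp.1 hVp.2 hc hsp hL hLc.isClosed (hζL p hp)
    rw [hv]
    exact Lame.rootCountingMeasure_prod_mem (by omega) hLc.measurableSet hvL
  have hQmem : ∀ p, 3 ≤ p → (Lame.rootCountingMeasure (Q₂ p)).mass = 1 ∧
      (Lame.rootCountingMeasure (Q₂ p) : Measure ℂ) Kᶜ = 0 := by
    intro p hp
    obtain ⟨ζ, a, -, hζ, -⟩ := hQ p (by omega)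
    have hζK : ∀ i, ζ i ∈ K := fun i => hKQ p (by omega) _ <| by
      rw [hζ, IsRoot, eval_prod]
      exact Finset.prod_eq_zero (Finset.mem_univ i) (by simp)
    rw [hζ]
    exact Lame.rootCountingMeasure_prod_mem (by omega) hK.measurableSet hζK
  refine ⟨?_, fun Γ μV μQ hΓ hlimV hlimQ => ?_⟩
  -- The shift by 3 skips p = 2, where V is constant and its root-counting measure is 0.
  · obtain ⟨φ, μV, hφ, hφV⟩ := Lame.exists_tendsto_subseq hLc
      (fun k => Lame.rootCountingMeasure (V (k + 3) (N (k + 3)))) fun k => hVmem _ (by omega)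
    obtain ⟨ψ, μQ, hψ, hψQ⟩ := Lame.exists_tendsto_subseq hK
      (fun k => Lame.rootCountingMeasure (Q₂ (φ k + 3))) fun k => hQmem _ (by omega)
    have hmono : StrictMono fun k => φ (ψ k) + 3 := fun a b hab =>
      Nat.add_lt_add_right (hφ (hψ hab)) 3
    refine ⟨Set.range fun k => φ (ψ k) + 3, μV, μQ, Set.infinite_range_of_injective
      hmono.injective, ?_, ?_⟩
    · rw [Lame.WeakStarLim, ← Lame.map_atTop_of_strictMono hmono, tendsto_map'_iff]
      exact hφV.comp hψ.tendsto_atTop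
    · rw [Lame.WeakStarLim, ← Lame.map_atTop_of_strictMono hmono, tendsto_map'_iff]
      exact hψQ
  have hne := Lame.neBot_atTop_inf_principal hΓ
  have hev : ∀ᶠ p in atTop ⊓ 𝓟 Γ, 3 ≤ p := (eventually_ge_atTop 3).filter_mono inf_le_left
  have hμV := (Lame.isCompact_setOf_mass_eq_one hLc).isClosed.mem_of_tendsto hlimV
    (hev.mono hVmem)
  have hμQ := (Lame.isCompact_setOf_mass_eq_one hK).isClosed.mem_of_tendsto hlimQ
    (hev.mono hQmem)
  have hKL' : ∀ μ : FiniteMeasure ℂ, (μ : Measure ℂ) Kᶜ = 0 → (μ : Measure ℂ) Lᶜ = 0 :=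
    fun μ h => measure_mono_null (Set.compl_subset_compl.2 hKL) h
  have hcoup : ∀ p, 3 ≤ p → ∃ π : FiniteMeasure (ℂ × ℂ),
      (π.mass = 1 ∧ (π : Measure (ℂ × ℂ)) (L ×ˢ L)ᶜ = 0) ∧
      (∀ f : ℂ → ℝ, ∫ x, f x.1 ∂(π : Measure (ℂ × ℂ)) =
        ∫ x, f x ∂(Lame.rootCountingMeasure (V p (N p)) : Measure ℂ)) ∧
      (∀ (f : ℂ → ℝ) (B : ℝ), (∀ x ∈ L, |f x| ≤ B) → |∫ x, f x.2 ∂(π : Measure (ℂ × ℂ)) -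
        ∫ x, f x ∂(Lame.rootCountingMeasure (Q₂ p) : Measure ℂ)| ≤ 6 * B / (p - 2 : ℕ)) ∧
      ∀ g : ℂ → ℝ, ∫ x, g x.1 • (x.2 - x.1) ∂(π : Measure (ℂ × ℂ)) = 0 := by
    intro p hp
    obtain ⟨c, hc, hsp⟩ := hSV p (N p) (by omega) (hN p (by omega))
    have hSp := hS p (N p) (by omega) (hN p (by omega))
    have hVp := hV p (N p) (by omega) (hN p (by omega))
    exact Lame.exists_approximate_martingale_coupling hp (hN p (by omega))
      (hQ p (by omega)) hSp.1 hSp.2 hVp.1 hVp.2 hc hsp hL hLc.isClosed (hζL p hp)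
  obtain ⟨π, hπ, hfst, hsnd, hmart⟩ := Lame.exists_martingale_coupling_of_tendsto hLc hne hev
    inf_le_left hlimV hlimQ hcoup
  have hπp : IsProbabilityMeasure (π : Measure (ℂ × ℂ)) :=
    ⟨by rw [← FiniteMeasure.ennreal_mass, hπ.1, ENNReal.coe_one]⟩
  obtain ⟨hle, hdil⟩ := Lame.choquetLE_and_exists_dilation_of_martingale hLc
    (π : Measure (ℂ × ℂ)) hπ.2 fun g hg _ => hmart g hg
  rw [hfst, hsnd] at hle hdil
  refine ⟨Lame.mem_probOn_of_mass_eq_one hμV, Lame.mem_probOn_of_mass_eq_one hμQ, hle, hdil,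
    fun m => ?_, fun z hz => ?_⟩
  · have := hle (fun w => ‖w‖ ^ m) (by fun_prop)
      ((convexOn_norm hL).pow (fun _ _ => norm_nonneg _) m)
    rwa [Lame.restrict_eq_self_of_null hμV.2,
      Lame.restrict_eq_self_of_null (hKL' _ hμQ.2)] at this
  · have hf : ContinuousOn (fun w => Real.log ‖z - w‖) L :=
      ContinuousOn.log (by fun_prop) fun w hw h => hz (by
        rwa [sub_eq_zero.1 (norm_eq_zero.1 h)])
    obtain ⟨e, η, he, hη, hzL⟩ := Lame.exists_le_re_div hL hLc hz
    have hlim1 := Lame.tendsto_integral_of_continuousOn hLc hlimV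
      (hev.mono fun p hp => (hVmem p hp).2) hμV.2 hf
    have hlim2 := Lame.tendsto_integral_of_continuousOn hLc hlimQ
      (hev.mono fun p hp => hKL' _ (hQmem p hp).2) (hKL' _ hμQ.2) hf
    have hsub : Tendsto (fun p : ℕ => ((p - 2 : ℕ) : ℝ)) (atTop ⊓ 𝓟 Γ) atTop :=
      (tendsto_natCast_atTop_atTop.comp (tendsto_sub_atTop_nat 2)).mono_left inf_le_left
    have hc1 : Tendsto (fun p : ℕ => 2 * Real.log η / ((p - 2 : ℕ) : ℝ)) (atTop ⊓ 𝓟 Γ) (𝓝 0) :=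
      hsub.const_div_atTop _
    have hc2 : Tendsto (fun p : ℕ => (p : ℝ) / ((p - 2 : ℕ) : ℝ)) (atTop ⊓ 𝓟 Γ) (𝓝 1) := by
      have : Tendsto (fun p : ℕ => 1 + 2 / ((p - 2 : ℕ) : ℝ)) (atTop ⊓ 𝓟 Γ) (𝓝 1) := by
        simpa using (hsub.const_div_atTop 2).const_add 1
      refine this.congr' (hev.mono fun p hp => ?_)
      have hd0 : ((p - 2 : ℕ) : ℝ) ≠ 0 := by exact_mod_cast (by omega : p - 2 ≠ 0)
      have hd : (p : ℝ) = ((p - 2 : ℕ) : ℝ) + 2 := by exact_mod_cast (by omega : p = p - 2 + 2)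
      rw [eq_div_iff hd0, hd]
      field_simp
    have hlim3 := hc1.add (hc2.mul hlim2)
    rw [zero_add, one_mul] at hlim3
    -- η depends only on z and `L`, so its logarithm divided by p - 2 disappears in the limit.
    refine le_of_tendsto_of_tendsto hlim3 hlim1 (hev.mono fun p hp => ?_)
    obtain ⟨c, hc, hsp⟩ := hSV p (N p) (by omega) (hN p (by omega))
    have hSp := hS p (N p) (by omega) (hN p (by omega))
    have hVp := hV p (N p) (by omega) (hN p (by omega))
    exact Lame.logPotential_rootCountingMeasure_le hp (hN p (by omega))
      (hQ p (by omega)) hSp.1 hSp.2 hVp.1 hVp.2 hc hsp hL hLc.isClosed (hζL p hp) hz he hη hzL
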